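/- Let $k$ be a field. For a finite-dimensional $k$-algebra $R$ let $R\text{-mod}$ be the category of finite-dimensional left $R$-modules, $\mathcal D^b(R\text{-mod})$ its bounded derived category, and $\mathcal K^b(R\text{-proj})$ the homotopy category of bounded complexes of finitely generated projective left $R$-modules. A complex $T\in\mathcal K^b(R\text{-proj})$ is called a tilting complex if $\operatorname{Hom}_{\mathcal K^b(R\text{-proj})}(T,T[i])=0$ for all integers $i\neq 0$ and $\operatorname{add}(T)$ (the direct summands of finite direct sums of copies of $T$) generates $\mathcal K^b(R\text{-proj})$ as a triangulated category. Let $A_0$ and $B_0$ be finite-dimensional $k$-algebras, let $\Phi_0:\mathcal D^b(A_0\text{-mod})\to\mathcal D^b(B_0\text{-mod})$ be a $k$-linear equivalence of triangulated categories, and let $T_0\in\mathcal K^b(A_0\text{-proj})$ be a tilting complex with $\Phi_0(T_0)\cong {}_{B_0}B_0$ in $\mathcal D^b(B_0\text{-mod})$. Let $G$ be a finite-dimensional division algebra over $k$ and let $N$ be a finite-dimensional $A_0$-$G$-bimodule on which $k$ acts centrally. Suppose that there are a finite-dimensional left $B_0$-module $N'$ and an isomorphism $\varphi:\Phi_0(N[0])\cong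 N'[0]$ in $\mathcal D^b(B_0\text{-mod})$. Then $N'$ becomes a $B_0$-$G$-bimodule, on which $k$ acts centrally, with the right $G$-action induced by that on $N$, i.e. such that $\rho'_g[0]\circ\varphi=\varphi\circ\Phi_0(\rho_g[0])$ for all $g\in G$, where $\rho_g:N\to N$ and $\rho'_g:N'\to N'$ denote right multiplication by $g$. Let $$A=\begin{pmatrix}A_0&N\\0&G\end{pmatrix},\qquad B=\begin{pmatrix}B_0&N'\\0&G\end{pmatrix},\qquad e_0=\begin{pmatrix}1&0\\0&0\end{pmatrix},\quad e_G=\begin{pmatrix}0&0\\0&1\end{pmatrix}\in A .$$ Then $T=(Ae_0\otimes_{A_0}T_0)\oplus Ae_G[0]$ lies in $\mathcal K^b(A\text{-proj})$, it is a tilting complex, and $\operatorname{End}_{\mathcal K^b(A\text{-proj})}(T)^{\mathrm{op}}\cong B$ as $k$-algebras. -/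

import Mathlib

open CategoryTheory CategoryTheory.Limits MulOpposite
open scoped TensorProduct ZeroObject

noncomputable section

namespace OnePoint

universe u v w

/-! ### The one-point extension algebra -/

/-- The matrices `(a n; 0 g)` with `a ∈ A₀`, `n ∈ N`, `g ∈ G`. -/
@[ext]
structure OnePointExt (A₀ N G : Type u) : Type u where
  /-- the upper left entry -/
  a : A₀
  /-- the upper right entry -/
  n : N
  /-- the lower right entry -/
  g : G

namespace OnePointExt

section Ring

variable {A₀ N G : Type u} [Ring A₀] [Ring G] [AddCommGroup N]

instance : Zero (OnePointExt A₀ N G) := ⟨⟨0, 0, 0⟩⟩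
instance : One (OnePointExt A₀ N G) := ⟨⟨1, 0, 1⟩⟩
instance : Add (OnePointExt A₀ N G) := ⟨fun x y => ⟨x.a + y.a, x.n + y.n, x.g + y.g⟩⟩
instance : Neg (OnePointExt A₀ N G) := ⟨fun x => ⟨-x.a, -x.n, -x.g⟩⟩

@[simp] lemma zero_a : (0 : OnePointExt A₀ N G).a = 0 := rfl
@[simp] lemma zero_n : (0 : OnePointExt A₀ N G).n = 0 := rfl
@[simp] lemma zero_g : (0 : OnePointExt A₀ N G).g = 0 := rfl
@[simp] lemma one_a : (1 : OnePointExt A₀ N G).a = 1 := rfl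
@[simp] lemma one_n : (1 : OnePointExt A₀ N G).n = 0 := rfl
@[simp] lemma one_g : (1 : OnePointExt A₀ N G).g = 1 := rfl
@[simp] lemma add_a (x y : OnePointExt A₀ N G) : (x + y).a = x.a + y.a := rfl
@[simp] lemma add_n (x y : OnePointExt A₀ N G) : (x + y).n = x.n + y.n := rfl
@[simp] lemma add_g (x y : OnePointExt A₀ N G) : (x + y).g = x.g + y.g := rfl
@[simp] lemma neg_a (x : OnePointExt A₀ N G) : (-x).a = -x.a := rfl
@[simp] lemma neg_n (x : OnePointExt A₀ N G) : (-x).n = -x.n := rfl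
@[simp] lemma neg_g (x : OnePointExt A₀ N G) : (-x).g = -x.g := rfl

variable [Module A₀ N] [Module Gᵐᵒᵖ N]

/-- Matrix multiplication; the right action of `g` on `N` is that of `op g ∈ Gᵐᵒᵖ`. -/
instance : Mul (OnePointExt A₀ N G) :=
  ⟨fun x y => ⟨x.a * y.a, x.a • y.n + op y.g • x.n, x.g * y.g⟩⟩

@[simp] lemma mul_a (x y : OnePointExt A₀ N G) : (x * y).a = x.a * y.a := rfl
@[simp] lemma mul_n (x y : OnePointExt A₀ N G) :
    (x * y).n = x.a • y.n + op y.g • x.n := rfl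
@[simp] lemma mul_g (x y : OnePointExt A₀ N G) : (x * y).g = x.g * y.g := rfl

variable [SMulCommClass A₀ Gᵐᵒᵖ N]

instance : Ring (OnePointExt A₀ N G) where
  add_assoc x y z := by ext <;> simp [add_assoc]
  zero_add x := by ext <;> simp
  add_zero x := by ext <;> simp
  add_comm x y := by ext <;> simp [add_comm]
  neg_add_cancel x := by ext <;> simp
  nsmul := nsmulRec
  zsmul := zsmulRec
  mul_assoc x y z := by
    ext
    · simp [mul_assoc]
    · simp [mul_smul, smul_add, add_assoc, smul_comm]
    · simp [mul_assoc]
  one_mul x := by ext <;> simp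
  mul_one x := by ext <;> simp
  zero_mul x := by ext <;> simp
  mul_zero x := by ext <;> simp
  left_distrib x y z := by
    ext
    · simp [mul_add]
    · simp only [mul_n, add_n, add_g, smul_add, MulOpposite.op_add, add_smul]; abel
    · simp [mul_add]
  right_distrib x y z := by
    ext
    · simp [add_mul]
    · simp only [mul_n, add_n, add_a, smul_add, add_smul]; abel
    · simp [add_mul]

end Ring

section Algebra

variable (k : Type w) [Field k] {A₀ N G : Type u} [Ring A₀] [Algebra k A₀] [Ring G] [Algebra k G]
  [AddCommGroup N] [Module k N]

instance : SMul k (OnePointExt A₀ N G) := ⟨fun c x => ⟨c • x.a, c • x.n, c • x.g⟩⟩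

@[simp] lemma smul_a (c : k) (x : OnePointExt A₀ N G) : (c • x).a = c • x.a := rfl
@[simp] lemma smul_n (c : k) (x : OnePointExt A₀ N G) : (c • x).n = c • x.n := rfl
@[simp] lemma smul_g (c : k) (x : OnePointExt A₀ N G) : (c • x).g = c • x.g := rfl

variable [Module A₀ N] [Module Gᵐᵒᵖ N] [SMulCommClass A₀ Gᵐᵒᵖ N]

instance : Module k (OnePointExt A₀ N G) where
  one_smul x := by ext <;> simp
  mul_smul c d x := by ext <;> simp [mul_smul]
  smul_zero c := by ext <;> simp
  smul_add c x y := by ext <;> simp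
  add_smul c d x := by ext <;> simp [add_smul]
  zero_smul x := by ext <;> simp

variable [IsScalarTower k A₀ N] [IsScalarTower k Gᵐᵒᵖ N]

instance : Algebra k (OnePointExt A₀ N G) :=
  Algebra.ofModule
    (fun c x y => by
      ext
      · simp
      · have h : op y.g • c • x.n = c • op y.g • x.n := by
          rw [← algebraMap_smul A₀ c x.n, ← smul_comm, algebraMap_smul]
        simp [h]
      · simp)
    (fun c x y => by
      ext
      · simp
      · have h : x.a • c • y.n = c • x.a • y.n := by
          rw [← algebraMap_smul Gᵐᵒᵖ c y.n, smul_comm, algebraMap_smul]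
        simp [h]
      · simp)

/-- The entries, as a linear equivalence. -/
def linearEquiv : OnePointExt A₀ N G ≃ₗ[k] A₀ × N × G where
  toFun x := (x.a, x.n, x.g)
  invFun y := ⟨y.1, y.2.1, y.2.2⟩
  map_add' _ _ := rfl
  map_smul' _ _ := rfl

instance [FiniteDimensional k A₀] [FiniteDimensional k N] [FiniteDimensional k G] :
    FiniteDimensional k (OnePointExt A₀ N G) :=
  Module.Finite.equiv (linearEquiv k).symm

end Algebra

section Idempotents

variable (A₀ N G : Type u) [Ring A₀] [Ring G] [AddCommGroup N]

/-- The idempotent `(1 0; 0 0)`. -/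
def e₀ : OnePointExt A₀ N G := ⟨1, 0, 0⟩

/-- The idempotent `(0 0; 0 1)`. -/
def eG : OnePointExt A₀ N G := ⟨0, 0, 1⟩

variable [Module A₀ N] [Module Gᵐᵒᵖ N] [SMulCommClass A₀ Gᵐᵒᵖ N]

/-- The left ideal `A e₀` of the one-point extension `A`. -/
abbrev Ae₀ : Ideal (OnePointExt A₀ N G) := Ideal.span {e₀ A₀ N G}

/-- The left ideal `A e_G` of the one-point extension `A`. -/
abbrev AeG : Ideal (OnePointExt A₀ N G) := Ideal.span {eG A₀ N G}

variable {A₀ N G}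

lemma mem_Ae₀_iff (x : OnePointExt A₀ N G) : x ∈ Ae₀ A₀ N G ↔ x * e₀ A₀ N G = x := by
  rw [Ideal.mem_span_singleton']
  constructor
  · rintro ⟨y, rfl⟩
    ext <;> simp [e₀]
  · exact fun h => ⟨x, h⟩

/-- `A e₀` is a right `A₀`-module through `A₀ ≅ e₀ A e₀`, `a ↦ (a 0; 0 0)`. -/
instance : SMul A₀ᵐᵒᵖ (Ae₀ A₀ N G) :=
  ⟨fun s x => ⟨x.1 * ⟨s.unop, 0, 0⟩, by
    rw [mem_Ae₀_iff]; ext <;> simp [e₀]⟩⟩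

lemma coe_op_smul (s : A₀ᵐᵒᵖ) (x : Ae₀ A₀ N G) :
    ((s • x : Ae₀ A₀ N G) : OnePointExt A₀ N G) = x.1 * ⟨s.unop, 0, 0⟩ := rfl

instance : Module A₀ᵐᵒᵖ (Ae₀ A₀ N G) where
  one_smul x := Subtype.ext ((mem_Ae₀_iff x.1).1 x.2)
  mul_smul s t x := Subtype.ext (by
    simp only [coe_op_smul, mul_assoc]; congr 1; ext <;> simp)
  smul_zero s := Subtype.ext (by simp [coe_op_smul])
  smul_add s x y := Subtype.ext (by simp [coe_op_smul, add_mul])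
  add_smul s t x := Subtype.ext (by
    simp only [coe_op_smul, Submodule.coe_add, ← mul_add]; congr 1; ext <;> simp)
  zero_smul x := Subtype.ext (by simp only [coe_op_smul]; ext <;> simp)

instance : SMulCommClass (OnePointExt A₀ N G) A₀ᵐᵒᵖ (Ae₀ A₀ N G) where
  smul_comm r s x := Subtype.ext (by simp [coe_op_smul, mul_assoc])

end Idempotents

end OnePointExt

/-! ### Finite-dimensional modules -/

/-- The category `A-mod` of finite-dimensional left modules over a finite-dimensional
`k`-algebra `A`; these are the finitely generated ones. -/
def FDMod (k : Type w) (A : Type u) [Field k] [Ring A] [Algebra k A] : Type (u + 1) :=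
  FGModuleCat.{u} A

namespace FDMod

variable (k : Type w) (A : Type u) [Field k] [Ring A] [Algebra k A]

instance : Category.{u} (FDMod k A) := inferInstanceAs (Category.{u} (FGModuleCat.{u} A))

instance [FiniteDimensional k A] : Abelian (FDMod k A) :=
  haveI : IsNoetherianRing A := IsNoetherianRing.of_finite k A
  inferInstanceAs (Abelian (FGModuleCat.{u} A))

instance [FiniteDimensional k A] : Linear k (FDMod k A) :=
  inferInstanceAs (Linear k (FGModuleCat.{u} A))

variable {k A} in
/-- The underlying module. -/
abbrev toModule (X : FDMod k A) : Type u := FGModuleCat.carrier X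

/-- A finite-dimensional module, as an object of `A-mod`. -/
def of (X : Type u) [AddCommGroup X] [Module k X] [Module A X] [IsScalarTower k A X]
    [FiniteDimensional k X] : FDMod k A :=
  haveI : Module.Finite A X := Module.Finite.of_restrictScalars_finite k A X
  FGModuleCat.of A X

/-- A finitely generated module, as an object of `A-mod`. -/
def ofFG (X : Type u) [AddCommGroup X] [Module A X] [Module.Finite A X] : FDMod k A :=
  FGModuleCat.of A X

variable {k A} in
/-- A linear map, as a morphism of `A-mod`. -/
def ofHom {X Y : Type u} [AddCommGroup X] [Module k X] [Module A X] [IsScalarTower k A X]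
    [FiniteDimensional k X] [AddCommGroup Y] [Module k Y] [Module A Y] [IsScalarTower k A Y]
    [FiniteDimensional k Y] (f : X →ₗ[A] Y) : of k A X ⟶ of k A Y :=
  ObjectProperty.homMk (ModuleCat.ofHom f)

end FDMod

/-- Right multiplication by `g` on a bimodule, as an endomorphism of the left module. -/
def rightMul {R G X : Type u} [Ring R] [Ring G] [AddCommGroup X] [Module R X] [Module Gᵐᵒᵖ X]
    [SMulCommClass R Gᵐᵒᵖ X] (g : G) : X →ₗ[R] X where
  toFun x := op g • x
  map_add' := smul_add _
  map_smul' r x := (smul_comm r (op g) x).symm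

/-! ### The tensor product over a noncommutative ring -/

section Tensor

variable (R S M : Type u) [Ring R] [Ring S] [AddCommGroup M] [Module R M] [Module Sᵐᵒᵖ M]
  (X Y : Type u) [AddCommGroup X] [Module S X] [AddCommGroup Y] [Module S Y]

/-- The relations `m s ⊗ x = m ⊗ s x`. -/
def balancedRel : Submodule R (M ⊗[ℤ] X) :=
  Submodule.span R {t | ∃ (m : M) (s : S) (x : X), t = (op s • m) ⊗ₜ[ℤ] x - m ⊗ₜ[ℤ] (s • x)}

/-- The left `R`-module `M ⊗_S X`, for an `R`-`S`-bimodule `M` and a left `S`-module `X`. -/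
abbrev BalTensor : Type u := (M ⊗[ℤ] X) ⧸ balancedRel R S M X

variable {X Y}

/-- The class of `m ⊗ x` in `M ⊗_S X`. -/
def BalTensor.tmul (m : M) (x : X) : BalTensor R S M X :=
  (balancedRel R S M X).mkQ (m ⊗ₜ[ℤ] x)

lemma BalTensor.smul_tmul (m : M) (s : S) (x : X) :
    BalTensor.tmul R S M (op s • m) x = BalTensor.tmul R S M m (s • x) := by
  refine (Submodule.Quotient.eq _).2 (Submodule.subset_span ⟨m, s, x, rfl⟩)

/-- The map `M ⊗_S f`. -/
def BalTensor.map (f : X →ₗ[S] Y) : BalTensor R S M X →ₗ[R] BalTensor R S M Y :=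
  Submodule.mapQ _ _
    (TensorProduct.AlgebraTensorModule.map (LinearMap.id : M →ₗ[R] M)
      f.toAddMonoidHom.toIntLinearMap)
    (Submodule.span_le.2 (by
      rintro _ ⟨m, s, x, rfl⟩
      exact Submodule.subset_span ⟨m, s, f x, by simp⟩))

lemma BalTensor.map_tmul (f : X →ₗ[S] Y) (m : M) (x : X) :
    BalTensor.map R S M f (BalTensor.tmul R S M m x) = BalTensor.tmul R S M m (f x) := rfl

variable {R S M} in
lemma BalTensor.hom_ext {P : Type*} [AddCommGroup P] [Module R P]
    {f g : BalTensor R S M X →ₗ[R] P}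
    (h : ∀ m x, f (BalTensor.tmul R S M m x) = g (BalTensor.tmul R S M m x)) : f = g := by
  refine Submodule.linearMap_qext _ (LinearMap.ext fun t => ?_)
  induction t with
  | zero => simp
  | tmul m x => exact h m x
  | add a b ha hb => rw [map_add, map_add, ha, hb]

instance BalTensor.finite [Module.Finite R M] [Module.Finite S X] :
    Module.Finite R (BalTensor R S M X) := by
  obtain ⟨n, v, hv⟩ := Module.Finite.exists_fin (R := S) (M := X)
  let L (x : X) : M →ₗ[R] BalTensor R S M X :=
    { toFun m := BalTensor.tmul R S M m x
      map_add' m m' := by simp [BalTensor.tmul, TensorProduct.add_tmul]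
      map_smul' r m := by simp [BalTensor.tmul, ← TensorProduct.smul_tmul'] }
  let F : (Fin n → M) →ₗ[R] BalTensor R S M X := ∑ i, L (v i) ∘ₗ LinearMap.proj i
  refine Module.Finite.of_surjective F (LinearMap.range_eq_top.1 ?_)
  have key : ∀ m x, BalTensor.tmul R S M m x ∈ LinearMap.range F := fun m x => by
    have hx : x ∈ Submodule.span S (Set.range v) := hv ▸ Submodule.mem_top
    obtain ⟨c, rfl⟩ := (Submodule.mem_span_range_iff_exists_fun S).1 hx
    refine ⟨fun i => op (c i) • m, ?_⟩
    have : F (fun i => op (c i) • m) = ∑ i, BalTensor.tmul R S M (op (c i) • m) (v i) := by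
      simp only [F, LinearMap.sum_apply]; rfl
    rw [this]
    simp only [BalTensor.smul_tmul]
    simp [BalTensor.tmul, TensorProduct.tmul_sum]
  refine eq_top_iff.2 fun t _ => ?_
  obtain ⟨t, rfl⟩ := Submodule.mkQ_surjective _ t
  induction t with
  | zero => simp
  | tmul m x => exact key m x
  | add a b ha hb => rw [map_add]; exact add_mem (ha trivial) (hb trivial)

end Tensor

/-- The functor `M ⊗_S -` from `S-mod` to `R-mod`. -/
def tensorFunctor (k : Type w) [Field k] (R S M : Type u) [Ring R] [Algebra k R] [Ring S]
    [Algebra k S] [AddCommGroup M] [Module R M] [Module Sᵐᵒᵖ M] [SMulCommClass R Sᵐᵒᵖ M]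
    [Module.Finite R M] : FDMod k S ⥤ FDMod k R where
  obj X :=
    haveI : Module.Finite S X.toModule := X.property
    FDMod.ofFG k R (BalTensor R S M X.toModule)
  map f := ObjectProperty.homMk (ModuleCat.ofHom (BalTensor.map R S M f.hom.hom))
  map_id _ := ObjectProperty.hom_ext _ (ModuleCat.hom_ext (BalTensor.hom_ext fun _ _ => rfl))
  map_comp _ _ := ObjectProperty.hom_ext _ (ModuleCat.hom_ext (BalTensor.hom_ext fun _ _ => rfl))

instance (k : Type w) [Field k] (R S M : Type u) [Ring R] [Algebra k R] [FiniteDimensional k R]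
    [Ring S] [Algebra k S] [FiniteDimensional k S] [AddCommGroup M] [Module R M]
    [Module Sᵐᵒᵖ M] [SMulCommClass R Sᵐᵒᵖ M] [Module.Finite R M] :
    (tensorFunctor k R S M).Additive where
  map_add {X Y f g} := by
    have h : BalTensor.map R S M (f.hom.hom + g.hom.hom) =
        BalTensor.map R S M f.hom.hom + BalTensor.map R S M g.hom.hom :=
      BalTensor.hom_ext fun m x => by
        rw [LinearMap.add_apply, BalTensor.map_tmul, BalTensor.map_tmul, BalTensor.map_tmul,
          LinearMap.add_apply, BalTensor.tmul, TensorProduct.tmul_add, map_add]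
        rfl
    exact ObjectProperty.hom_ext _ (ModuleCat.hom_ext h)

/-! ### Bounded complexes of projectives, and the bounded derived category -/

section Kb

variable (k : Type w) [Field k] (A : Type u) [Ring A] [Algebra k A] [FiniteDimensional k A]

/-- The bounded complexes of (finitely generated) projective modules. -/
def isBoundedProj : ObjectProperty (HomotopyCategory (FDMod k A) (.up ℤ)) := fun K =>
  (∃ n : ℤ, CochainComplex.IsStrictlyGE K.as n) ∧ (∃ n : ℤ, CochainComplex.IsStrictlyLE K.as n) ∧
    ∀ i : ℤ, Module.Projective A (FDMod.toModule (K.as.X i))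

/-- `K^b(A-proj)`, a full subcategory of the homotopy category of complexes in `A-mod`. -/
abbrev KbProj : Type (u + 1) := (isBoundedProj k A).FullSubcategory

instance : (isBoundedProj k A).ContainsZero where
  exists_zero := by
    refine ⟨(HomotopyCategory.quotient _ _).obj 0, Functor.map_isZero _ (isZero_zero _),
      ⟨0, ?_⟩, ⟨0, ?_⟩, fun i => ?_⟩
    · exact inferInstanceAs (CochainComplex.IsStrictlyGE (0 : CochainComplex (FDMod k A) ℤ) 0)
    · exact inferInstanceAs (CochainComplex.IsStrictlyLE (0 : CochainComplex (FDMod k A) ℤ) 0)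
    · have h : IsZero ((0 : CochainComplex (FDMod k A) ℤ).X i) :=
        (HomologicalComplex.eval _ _ i).map_isZero (isZero_zero _)
      have : Subsingleton (FDMod.toModule ((0 : CochainComplex (FDMod k A) ℤ).X i)) :=
        ⟨fun a b => by
          have h' := (IsZero.iff_id_eq_zero _).1 h
          have h'' := fun c => congrArg
            (fun f : (0 : CochainComplex (FDMod k A) ℤ).X i ⟶ _ => f.hom.hom c) h'
          exact (h'' a).trans (h'' b).symm⟩
      exact inferInstanceAs
        (Module.Projective A (FDMod.toModule ((0 : CochainComplex (FDMod k A) ℤ).X i)))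

instance : (isBoundedProj k A).IsStableUnderShift ℤ where
  isStableUnderShiftBy n :=
    { le_shift K hK := by
        obtain ⟨K : CochainComplex _ _, rfl⟩ := K.quotient_obj_surjective
        obtain ⟨⟨p, hp⟩, ⟨q, hq⟩, h⟩ := hK
        replace hp : CochainComplex.IsStrictlyGE K p := hp
        replace hq : CochainComplex.IsStrictlyLE K q := hq
        rw [ObjectProperty.prop_shift_iff, HomotopyCategory.shift_quotient_obj]
        exact ⟨⟨p - n, CochainComplex.isStrictlyGE_shift K p n (p - n) (by lia)⟩,
          ⟨q - n, CochainComplex.isStrictlyLE_shift K q n (q - n) (by lia)⟩, fun i => h (i + n)⟩ }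

lemma projective_mappingCone {K L : CochainComplex (FDMod k A) ℤ} (f : K ⟶ L)
    (hK : ∀ i, Module.Projective A (FDMod.toModule (K.X i)))
    (hL : ∀ i, Module.Projective A (FDMod.toModule (L.X i))) (i : ℤ) :
    Module.Projective A (FDMod.toModule ((CochainComplex.mappingCone f).X i)) := by
  have := hK (i + 1)
  have := hL i
  have h := CochainComplex.mappingCone.id_X f i (i + 1) rfl
  let a := ((CochainComplex.mappingCone.fst f).1.v i (i + 1) rfl).hom.hom
  let a' := ((CochainComplex.mappingCone.inl f).v (i + 1) i (by lia)).hom.hom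
  let b := ((CochainComplex.mappingCone.snd f).v i i (by lia)).hom.hom
  let b' := ((CochainComplex.mappingCone.inr f).f i).hom.hom
  refine Module.Projective.of_split (a.prod b) (a'.coprod b') (LinearMap.ext fun x => ?_)
  exact (congrArg (fun φ : (CochainComplex.mappingCone f).X i ⟶ _ => φ.hom.hom x) h)

instance : (isBoundedProj k A).IsTriangulatedClosed₃ where
  ext₃' T hT h₁ h₂ := by
    obtain ⟨⟨p₁, _⟩, ⟨q₁, _⟩, h₁⟩ := h₁
    obtain ⟨⟨p₂, _⟩, ⟨q₂, _⟩, h₂⟩ := h₂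
    obtain ⟨f : T.obj₁.as ⟶ T.obj₂.as, hf⟩ := (HomotopyCategory.quotient _ _).map_surjective T.mor₁
    refine ⟨_, ⟨⟨min (p₁ - 1) p₂, CochainComplex.isStrictlyGE_mappingCone f p₁ p₂ _
        (by simp) (by simp)⟩, ⟨max (q₁ - 1) q₂, ?_⟩, projective_mappingCone k A f h₁ h₂⟩,
      ⟨Pretriangulated.Triangle.π₃.mapIso (Pretriangulated.isoTriangleOfIso₁₂ T _ hT
        (HomotopyCategory.mappingCone_triangleh_distinguished f)
        (Iso.refl _) (Iso.refl _) ?_)⟩⟩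
    · rw [CochainComplex.isStrictlyLE_iff]
      intro i hi
      rw [max_lt_iff] at hi
      exact (CochainComplex.mappingCone.isZero_X_iff f i).2
        ⟨CochainComplex.isZero_of_isStrictlyLE _ q₁ _ (by lia),
          CochainComplex.isZero_of_isStrictlyLE _ q₂ _ (by lia)⟩
    · exact (Category.comp_id _).trans (hf.symm.trans (Category.id_comp _).symm)

instance : (isBoundedProj k A).IsTriangulated where
  toIsTriangulatedClosed₂ := .of_isTriangulatedClosed₃

variable {k A}

/-- `add(T)`: the direct summands of finite direct sums of copies of `T`. -/
def addClosure (T : KbProj k A) : ObjectProperty (KbProj k A) := fun X =>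
  ∃ (n : ℕ) (b : Bicone (fun _ : Fin n => T)), Nonempty b.IsBilimit ∧ Nonempty (Retract X b.pt)

/-- Tilting complexes: no nonzero morphisms from `T` to its proper shifts, and `K^b(A-proj)` is
the only full triangulated subcategory (closed under isomorphisms) of `K^b(A-proj)` that
contains `add(T)`. -/
structure IsTiltingComplex (T : KbProj k A) : Prop where
  hom_shift_eq_zero : ∀ (i : ℤ), i ≠ 0 → ∀ f : T ⟶ T⟦i⟧, f = 0
  generates : ∀ P : ObjectProperty (KbProj k A), P.IsTriangulated → P.IsClosedUnderIsomorphisms →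
    addClosure T ≤ P → ∀ X, P X

variable (k A)

/-- The canonical functor from `K^b(A-proj)` to `D^b(A-mod)`. -/
def KbProj.toDb [HasDerivedCategory.{v} (FDMod k A)] :
    KbProj k A ⥤ DerivedCategory.Bounded (FDMod k A) :=
  ObjectProperty.lift _ ((isBoundedProj k A).ι ⋙ DerivedCategory.Qh) (by
    rintro ⟨K, hK⟩
    obtain ⟨K, rfl⟩ := HomotopyCategory.quotient_obj_surjective K
    obtain ⟨⟨p, hp⟩, ⟨q, hq⟩, -⟩ := hK
    replace hp : CochainComplex.IsStrictlyGE K p := hp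
    replace hq : CochainComplex.IsStrictlyLE K q := hq
    exact ⟨⟨p, DerivedCategory.TStructure.t.isGE_of_iso
        ((DerivedCategory.quotientCompQhIso _).symm.app K) p⟩,
      ⟨q, DerivedCategory.TStructure.t.isLE_of_iso
        ((DerivedCategory.quotientCompQhIso _).symm.app K) q⟩⟩)

/-- The functor from `A-mod` to `D^b(A-mod)` sending `X` to the stalk complex `X[0]`. -/
def stalk [HasDerivedCategory.{v} (FDMod k A)] :
    FDMod k A ⥤ DerivedCategory.Bounded (FDMod k A) :=
  ObjectProperty.lift _ (DerivedCategory.singleFunctor (FDMod k A) 0)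
    (fun _ => ⟨⟨0, inferInstance⟩, ⟨0, inferInstance⟩⟩)

end Kb

section Main

variable (k : Type w) [Field k] {A₀ : Type u} [Ring A₀] [Algebra k A₀] [FiniteDimensional k A₀]
  (N G : Type u) [Ring G] [Algebra k G] [FiniteDimensional k G]
  [AddCommGroup N] [Module k N] [FiniteDimensional k N] [Module A₀ N] [Module Gᵐᵒᵖ N]
  [SMulCommClass A₀ Gᵐᵒᵖ N] [IsScalarTower k A₀ N] [IsScalarTower k Gᵐᵒᵖ N]

/-- The complex `(A e₀ ⊗_{A₀} T₀) ⊕ A e_G[0]` of modules over the one-point extension `A`. -/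
def extComplex (T₀ : CochainComplex (FDMod k A₀) ℤ) :
    CochainComplex (FDMod k (OnePointExt A₀ N G)) ℤ :=
  ((tensorFunctor k (OnePointExt A₀ N G) A₀ (OnePointExt.Ae₀ A₀ N G)).mapHomologicalComplex
      (.up ℤ)).obj T₀ ⊞
    (HomologicalComplex.single _ (.up ℤ) 0).obj (FDMod.ofFG k _ (OnePointExt.AeG A₀ N G))

end Main

end OnePoint

end

open OnePoint

universe w u v₁ v₂

set_option linter.unusedSectionVars false

noncomputable section

/-! Since `e_G A e₀ = 0`, the module `A e₀ ⊗_{A₀} X` is just `X` with `A` acting through `A → A₀`.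
Write `Ind` for this functor. It is fully faithful and preserves projectives, also on complexes up
to homotopy. The other summand `A e_G` is projective, and the morphisms between the two kinds of
summand are as follows. `Hom(A e_G, Ind X) = e_G · Ind X = 0`, `End(A e_G) = e_G A e_G = G` by right
multiplications, and `Hom_A(Ind X, A e_G) = Hom_{A₀}(X, N)`, because `Ind N = e₀ A e_G` is the
universal object of the form `Ind Z` over `A e_G` (`isCoreflection_inclN`). The last bijection is
natural in `X`, so it passes to complexes and homotopies
(`bijective_mapHomotopyCategory_of_isCoreflection`).

Hence `Hom(Ind T₀, A e_G[i]) = Hom_K(T₀, N[i])`. As `T₀` is K-projective this may be computed in the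
derived category, where `Φ₀` turns it into `Hom(B₀, N'[i])`: it is `N'` for `i = 0` and zero
otherwise. The block `Ind T₀` to `Ind T₀[i]` is that of `T₀`, with degree zero part `B₀`. This gives
both the vanishing required of a tilting complex (`isTiltingComplex_kbExt`) and the triangular
endomorphism algebra with entries `B₀`, `N'`, `G` (`nonempty_end_kbExt_algEquiv`). The bimodule
structure on `N'` is the one that makes the off-diagonal entry compatible with `G`
(`exists_transported_bimodule`).

For generation, let a triangulated subcategory contain `add(T)`. Its preimage under `Ind` contains
`add(T₀)`, hence everything. A finitely generated projective `A`-module is built by split extensions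
from copies of `A e_G` and one `Ind X` with `X` projective (`prop_single_of_projective`), and
bounded complexes of projectives are built from their terms by brutal truncation
(`prop_of_bounded_projective`). -/

namespace OnePoint

universe v

/-! ### Coreflections along an additive functor, and their passage to homotopy categories. -/

section Homotopy

variable {C D : Type*} [Category* C] [Category* D] [Preadditive C] [Preadditive D]
  (F : C ⥤ D) [F.Additive] {ι : Type*} {c : ComplexShape ι}

/-- Maps out of objects `F.obj X` factor uniquely through `t : F.obj Z ⟶ W`. -/
def IsCoreflection {Z : C} {W : D} (t : F.obj Z ⟶ W) : Prop :=
  ∀ X : C, Function.Bijective (fun f : X ⟶ Z => F.map f ≫ t)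

variable {F}

lemma IsCoreflection.comp_iso {Z : C} {W W' : D} {t : F.obj Z ⟶ W} (ht : IsCoreflection F t)
    (e : W ≅ W') : IsCoreflection F (t ≫ e.hom) := fun X => by
  have : (fun f : X ⟶ Z => F.map f ≫ t ≫ e.hom) = (fun g => g ≫ e.hom) ∘ (fun f => F.map f ≫ t) := by
    ext f; simp
  rw [this]
  exact Function.Bijective.comp (Iso.homToEquiv e).bijective (ht X)

lemma IsCoreflection.iso_comp {Z Z' : C} {W : D} {t : F.obj Z ⟶ W} (ht : IsCoreflection F t)
    (e : Z' ≅ Z) : IsCoreflection F (F.map e.hom ≫ t) := fun X => by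
  have : (fun f : X ⟶ Z' => F.map f ≫ F.map e.hom ≫ t) =
      (fun f => F.map f ≫ t) ∘ (fun g => g ≫ e.hom) := by
    ext f; simp
  rw [this]
  exact (ht X).comp (Iso.homToEquiv e).bijective

lemma isCoreflection_of_isZero {Z : C} {W : D} (t : F.obj Z ⟶ W) (hZ : IsZero Z) (hW : IsZero W) :
    IsCoreflection F t := fun _ =>
  ⟨fun _ _ _ => hZ.eq_of_tgt _ _, fun _ => ⟨0, hW.eq_of_tgt _ _⟩⟩

/-- A degreewise coreflection of complexes induces a coreflection on homotopy categories. -/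
lemma bijective_mapHomotopyCategory_of_isCoreflection {K Z : HomologicalComplex C c}
    {W : HomologicalComplex D c} (t : (F.mapHomologicalComplex c).obj Z ⟶ W)
    (ht : ∀ i, IsCoreflection F (t.f i)) :
    Function.Bijective (fun f : (HomotopyCategory.quotient C c).obj K ⟶
        (HomotopyCategory.quotient C c).obj Z =>
      (F.mapHomotopyCategory c).map f ≫ (HomotopyCategory.quotient D c).map t) := by
  let t' : ∀ i, F.obj (Z.X i) ⟶ W.X i := t.f
  have ht' : ∀ i, IsCoreflection F (t' i) := ht
  have tc : ∀ i j, t' i ≫ W.d i j = F.map (Z.d i j) ≫ t' j := t.comm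
  constructor
  · intro f₁ f₂ h
    obtain ⟨f₁, rfl⟩ := (HomotopyCategory.quotient _ _).map_surjective f₁
    obtain ⟨f₂, rfl⟩ := (HomotopyCategory.quotient _ _).map_surjective f₂
    have H := HomotopyCategory.homotopyOfEq ((F.mapHomologicalComplex c).map f₁ ≫ t)
      ((F.mapHomologicalComplex c).map f₂ ≫ t) (by
        rw [Functor.map_comp, Functor.map_comp]; exact h)
    let s' : ∀ i j, F.obj (K.X i) ⟶ W.X j := H.hom
    -- Every component of the homotopy factors uniquely through `t`. By uniqueness the homotopy
    -- identities for the factors may be checked after composing with `t`.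
    choose s hs using fun i j => (ht' j (K.X i)).2 (s' i j)
    dsimp only at hs
    have hc : ∀ i, F.map (f₁.f i) ≫ t' i = F.map (K.d i (c.next i)) ≫ s' (c.next i) i +
        s' i (c.prev i) ≫ W.d (c.prev i) i + F.map (f₂.f i) ≫ t' i := H.comm
    refine HomotopyCategory.eq_of_homotopy _ _
      { hom := s
        zero := fun i j hij => (ht' j (K.X i)).1 ?_
        comm := fun i => (ht' i (K.X i)).1 ?_ }
    · have h0 : s' i j = 0 := H.zero i j hij
      simp [hs, h0]
    · change F.map (f₁.f i) ≫ t' i = F.map (K.d i (c.next i) ≫ s (c.next i) i +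
        s i (c.prev i) ≫ Z.d (c.prev i) i + f₂.f i) ≫ t' i
      simp [hc, ← hs, tc]
  · intro h
    obtain ⟨h, rfl⟩ := (HomotopyCategory.quotient _ _).map_surjective h
    let h' : ∀ i, F.obj (K.X i) ⟶ W.X i := h.f
    have hc : ∀ i j, h' i ≫ W.d i j = F.map (K.d i j) ≫ h' j := h.comm
    -- The same descent for a chain map: uniqueness of the factors forces them to commute with the
    -- differentials.
    choose s hs using fun i => (ht' i (K.X i)).2 (h' i)
    dsimp only at hs
    refine ⟨(HomotopyCategory.quotient _ _).map
      { f := s, comm' := fun i j _ => (ht' j (K.X i)).1 ?_ }, ?_⟩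
    · simp only [Functor.map_comp, Category.assoc, hs, ← hc, ← tc]
      simp only [← Category.assoc, hs]
    · dsimp only
      rw [Functor.mapHomotopyCategory_map]
      refine ((HomotopyCategory.quotient D c).map_comp _ _).symm.trans ?_
      congr 1
      ext i
      exact hs i

/-- A coreflection, as a morphism of stalk complexes. -/
def singleCoreflection [HasZeroObject C] [HasZeroObject D] [DecidableEq ι] {Z : C} {W : D}
    (t : F.obj Z ⟶ W) (j : ι) :
    (F.mapHomologicalComplex c).obj ((HomologicalComplex.single C c j).obj Z) ⟶
      (HomologicalComplex.single D c j).obj W :=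
  (HomologicalComplex.singleMapHomologicalComplex F c j).hom.app Z ≫
    (HomologicalComplex.single D c j).map t

lemma isCoreflection_single [HasZeroObject C] [HasZeroObject D] [DecidableEq ι] {Z : C} {W : D}
    {t : F.obj Z ⟶ W} (ht : IsCoreflection F t) (j i : ι) :
    IsCoreflection F ((singleCoreflection (c := c) t j).f i) := by
  by_cases h : i = j
  · subst h
    have := (ht.comp_iso (HomologicalComplex.singleObjXSelf c i W).symm).iso_comp
      (HomologicalComplex.singleObjXSelf c i Z)
    have e : (singleCoreflection (c := c) t i).f i =
        F.map (HomologicalComplex.singleObjXSelf c i Z).hom ≫ t ≫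
          (HomologicalComplex.singleObjXSelf c i W).symm.hom := by
      refine (HomologicalComplex.comp_f _ _ i).trans ?_
      rw [HomologicalComplex.single_map_f_self,
        HomologicalComplex.singleMapHomologicalComplex_hom_app_self]
      exact (Category.assoc _ _ _).trans (congrArg _ (Iso.inv_hom_id_assoc _ _))
    rw [e]
    exact this
  · exact isCoreflection_of_isZero _ (HomologicalComplex.isZero_single_obj_X _ _ _ _ h)
      (HomologicalComplex.isZero_single_obj_X _ _ _ _ h)

end Homotopy

/-! ### Morphisms out of stalk complexes in the homotopy category. -/

section Single

variable {C : Type*} [Category* C] [Abelian C]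

/-- The composite to the derived category is already faithful, so the first factor is. -/
instance (n : ℤ) : (HomotopyCategory.singleFunctor C n).Faithful :=
  letI := HasDerivedCategory.standard C
  have : (HomotopyCategory.singleFunctor C n ⋙ DerivedCategory.Qh).Faithful :=
    inferInstanceAs (DerivedCategory.singleFunctor C n).Faithful
  Functor.Faithful.of_comp _ DerivedCategory.Qh

instance (n : ℤ) : (HomotopyCategory.singleFunctor C n).Full :=
  inferInstanceAs (CochainComplex.singleFunctor C n ⋙ HomotopyCategory.quotient _ _).Full

/-- There are no nonzero morphisms from a stalk complex to a complex vanishing in its degree. -/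
lemma single_hom_eq_zero {M : C} {n : ℤ} {L : CochainComplex C ℤ} (h : ∀ g : M ⟶ L.X n, g = 0)
    (f : (HomotopyCategory.singleFunctor C n).obj M ⟶ (HomotopyCategory.quotient _ _).obj L) :
    f = 0 := by
  obtain ⟨f, rfl⟩ := (HomotopyCategory.quotient _ _).map_surjective f
  have : f = 0 := HomologicalComplex.from_single_hom_ext (by
    rw [← cancel_epi (HomologicalComplex.singleObjXSelf (.up ℤ) n M).inv]
    exact (h _).trans comp_zero.symm)
  rw [this]
  exact Functor.map_zero _ _ _

lemma single_hom_shift_eq_zero {M : C} {L : CochainComplex C ℤ} (i : ℤ)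
    (h : ∀ g : M ⟶ L.X i, g = 0)
    (f : (HomotopyCategory.singleFunctor C 0).obj M ⟶
      ((HomotopyCategory.quotient _ _).obj L)⟦i⟧) : f = 0 := by
  have e := ((HomotopyCategory.quotient C (.up ℤ)).commShiftIso i).app L
  rw [← cancel_mono e.inv, zero_comp]
  refine single_hom_eq_zero (L := L⟦i⟧) (fun g => ?_) _
  have e' : (L⟦i⟧).X 0 ≅ L.X i := L.XIsoOfEq (zero_add i)
  rw [← cancel_mono e'.hom, zero_comp]
  exact h _

lemma single_hom_single_shift_eq_zero {M M' : C} (i : ℤ) (hi : i ≠ 0)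
    (f : (HomotopyCategory.singleFunctor C 0).obj M ⟶
      ((HomotopyCategory.singleFunctor C 0).obj M')⟦i⟧) : f = 0 :=
  single_hom_shift_eq_zero (L := (CochainComplex.singleFunctor C 0).obj M') i
    (fun _ => (HomologicalComplex.isZero_single_obj_X (.up ℤ) 0 M' i hi).eq_of_tgt _ _) f

end Single

/-! ### Building bounded complexes of projectives from stalk complexes. -/

section Generation

open Pretriangulated

variable {C : Type*} [Category* C] [Abelian C]
  (P : ObjectProperty (HomotopyCategory C (.up ℤ))) [P.IsTriangulated]
  [P.IsClosedUnderIsomorphisms]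

/-- A degreewise split sequence of complexes is a distinguished triangle already up to homotopy. -/
lemma prop_of_degreewiseSplit (S : ShortComplex (CochainComplex C ℤ))
    (σ : ∀ n, (S.map (HomologicalComplex.eval C _ n)).Splitting)
    (h₁ : P ((HomotopyCategory.quotient _ _).obj S.X₁))
    (h₃ : P ((HomotopyCategory.quotient _ _).obj S.X₃)) :
    P ((HomotopyCategory.quotient _ _).obj S.X₂) :=
  P.ext_of_isTriangulatedClosed₂ (CochainComplex.trianglehOfDegreewiseSplit S σ)
    ((HomotopyCategory.distinguished_iff_iso_trianglehOfDegreewiseSplit _).2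
      ⟨S, σ, ⟨Iso.refl _⟩⟩) h₁ h₃

lemma prop_single_of_splitting (S : ShortComplex C) (σ : S.Splitting)
    (h₁ : P ((HomotopyCategory.singleFunctor C 0).obj S.X₁))
    (h₃ : P ((HomotopyCategory.singleFunctor C 0).obj S.X₃)) :
    P ((HomotopyCategory.singleFunctor C 0).obj S.X₂) :=
  prop_of_degreewiseSplit P (S.map (CochainComplex.singleFunctor C 0))
    (fun n => σ.map (CochainComplex.singleFunctor C 0 ⋙ HomologicalComplex.eval C _ n)) h₁ h₃

lemma prop_singleFunctor_iff (M : C) (n : ℤ) :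
    P ((HomotopyCategory.singleFunctor C n).obj M) ↔
      P ((HomotopyCategory.singleFunctor C 0).obj M) := by
  rw [← P.prop_iff_of_iso (((HomotopyCategory.singleFunctors C).shiftIso n 0 n
    (by simp)).app M)]
  exact (P.prop_shift_iff_of_isStableUnderShift _ _).symm

/-- Bounded complexes of projectives lie in every triangulated subcategory that contains the
stalk complexes of projectives. -/
lemma prop_of_bounded_projective
    (hP : ∀ M : C, Projective M → P ((HomotopyCategory.singleFunctor C 0).obj M)) (n : ℕ) :
    ∀ (p : ℤ) (K : CochainComplex C ℤ), K.IsStrictlyGE p → (∀ i, p + n ≤ i → IsZero (K.X i)) →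
      (∀ i, Projective (K.X i)) → P ((HomotopyCategory.quotient _ _).obj K) := by
  -- `n` counts the degrees `p, …, p + n - 1` in which `K` may be nonzero.
  induction n with
  | zero =>
    intro p K _ h _
    have : IsZero K := by
      rw [IsZero.iff_id_eq_zero]
      ext i
      by_cases hi : i < p
      · exact (K.isZero_of_isStrictlyGE p i hi).eq_of_src _ _
      · exact (h i (by simp; lia)).eq_of_src _ _
    exact P.prop_of_isZero (Functor.map_isZero _ this)
  | succ n ih =>
    intro p K hK h hproj
    -- The projection onto the lowest term is a chain map because nothing maps into degree `p`. Its
    -- kernel is the brutal truncation in degrees above `p`, to which the induction hypothesis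
    -- applies.
    let f : K ⟶ (CochainComplex.singleFunctor C p).obj (K.X p) :=
      HomologicalComplex.mkHomToSingle (𝟙 _) (fun i hi => by
        apply (K.isZero_of_isStrictlyGE p i (by simp at hi; lia)).eq_of_src)
    have hfp : IsIso (f.f p) := by
      dsimp only [f]
      rw [HomologicalComplex.mkHomToSingle_f]
      exact inferInstanceAs
        (IsIso (𝟙 (K.X p) ≫ (HomologicalComplex.singleObjXSelf (.up ℤ) p (K.X p)).inv))
    have hepi : ∀ i, Epi (f.f i) := fun i => by
      by_cases hi : i = p
      · subst hi; infer_instance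
      · exact ⟨fun _ _ _ => (HomologicalComplex.isZero_single_obj_X (.up ℤ) p _ i hi).eq_of_src _ _⟩
    have : Epi f := HomologicalComplex.epi_of_epi_f f hepi
    let S : ShortComplex (CochainComplex C ℤ) := ShortComplex.mk (kernel.ι f) f (by simp)
    have hS : S.ShortExact :=
      { exact := ShortComplex.exact_of_f_is_kernel _ (kernelIsKernel f)
        mono_f := inferInstanceAs (Mono (kernel.ι f))
        epi_g := this }
    have hproj₃ : ∀ i, Projective ((S.map (HomologicalComplex.eval C _ i)).X₃) := fun i => by
      by_cases hi : i = p
      · subst hi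
        exact Projective.of_iso (HomologicalComplex.singleObjXSelf (.up ℤ) i (K.X i)).symm (hproj i)
      · have h0 := HomologicalComplex.isZero_single_obj_X (.up ℤ) p (K.X p) i hi
        exact Projective.of_iso (h0.isoZero).symm inferInstance
    have hSi : ∀ i, (S.map (HomologicalComplex.eval C _ i)).ShortExact :=
      fun i => hS.map_of_exact _
    let σ : ∀ i, (S.map (HomologicalComplex.eval C _ i)).Splitting := fun i =>
      (hSi i).splittingOfProjective
    refine prop_of_degreewiseSplit P S σ ?_ ?_
    · refine ih (p + 1) S.X₁ ?_ ?_ ?_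
      · rw [CochainComplex.isStrictlyGE_iff]
        intro i hi
        by_cases hi' : i = p
        -- In degree `p` the projection is an isomorphism, so its kernel vanishes there.
        · subst hi'
          have hz : (S.map (HomologicalComplex.eval C _ i)).f = 0 := by
            have := (S.map (HomologicalComplex.eval C _ i)).zero
            have hfi : IsIso (S.map (HomologicalComplex.eval C _ i)).g := hfp
            exact (cancel_mono (S.map (HomologicalComplex.eval C _ i)).g).1 (this.trans zero_comp.symm)
          have := (σ i).f_r
          rw [hz, zero_comp] at this
          exact (IsZero.iff_id_eq_zero _).2 this.symm
        · rw [IsZero.iff_id_eq_zero]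
          refine ((σ i).f_r).symm.trans ?_
          have : (σ i).r = 0 := (K.isZero_of_isStrictlyGE p i (by lia)).eq_of_src _ _
          rw [this, comp_zero]; rfl
      · intro i hi
        rw [IsZero.iff_id_eq_zero]
        refine ((σ i).f_r).symm.trans ?_
        have : (σ i).r = 0 := (h i (by push_cast; lia)).eq_of_src _ _
        rw [this, comp_zero]; rfl
      · intro i
        have : Projective (S.map (HomologicalComplex.eval C _ i)).X₂ := hproj i
        exact (Retract.mk _ _ (σ i).f_r).projective
    · exact (prop_singleFunctor_iff P _ p).2 (hP _ (hproj p))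

end Generation

/-! ### Endomorphism algebras of a direct sum with one-sided morphisms. -/

section TriangularEnd

variable {k : Type w} [Field k] {C : Type*} [Category* C] [Preadditive C] [Linear k C]
  {X Y T : C} {R M S : Type u} [Ring R] [Algebra k R] [Ring S] [Algebra k S] [AddCommGroup M]
  [Module k M] [Module R M] [Module Sᵐᵒᵖ M] [SMulCommClass R Sᵐᵒᵖ M] [IsScalarTower k R M]
  [IsScalarTower k Sᵐᵒᵖ M]

/-- The endomorphism algebra of `X ⊕ Y` is triangular if there are no nonzero morphisms from `Y`
to `X`. -/
lemma nonempty_end_algEquiv_onePointExt (i₁ : X ⟶ T) (p₁ : T ⟶ X) (i₂ : Y ⟶ T) (p₂ : T ⟶ Y)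
    (h₁ : i₁ ≫ p₁ = 𝟙 X) (h₂ : i₂ ≫ p₂ = 𝟙 Y) (h₁₂ : i₁ ≫ p₂ = 0)
    (hid : p₁ ≫ i₁ + p₂ ≫ i₂ = 𝟙 T) (hYX : ∀ f : Y ⟶ X, f = 0)
    (α : R ≃+ (X ⟶ X)) (β : M ≃+ (X ⟶ Y)) (γ : S ≃+ (Y ⟶ Y))
    (hα : ∀ a b, α (a * b) = α a ≫ α b) (hγ : ∀ a b, γ (a * b) = γ a ≫ γ b)
    (hαβ : ∀ a m, β (a • m) = α a ≫ β m) (hβγ : ∀ m s, β (op s • m) = β m ≫ γ s)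
    (hαk : ∀ c : k, α (algebraMap k R c) = c • 𝟙 X) (hγk : ∀ c : k, γ (algebraMap k S c) = c • 𝟙 Y) :
    Nonempty ((End T)ᵐᵒᵖ ≃ₐ[k] OnePointExt R M S) := by
  have h₂₁ : i₂ ≫ p₁ = 0 := hYX _
  -- Products in `(End T)ᵐᵒᵖ` are composites in diagrammatic order, which is why `α`, `β`, `γ` are
  -- assumed compatible with `≫` without reversal.
  let φ : OnePointExt R M S → (T ⟶ T) := fun x =>
    p₁ ≫ α x.a ≫ i₁ + p₁ ≫ β x.n ≫ i₂ + p₂ ≫ γ x.g ≫ i₂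
  have r₁ : ∀ {Z} (f : X ⟶ Z), i₁ ≫ p₁ ≫ f = f := fun f => by rw [← Category.assoc, h₁, Category.id_comp]
  have r₂ : ∀ {Z} (f : Y ⟶ Z), i₂ ≫ p₂ ≫ f = f := fun f => by rw [← Category.assoc, h₂, Category.id_comp]
  have r₃ : ∀ {Z} (f : Y ⟶ Z), i₁ ≫ p₂ ≫ f = 0 := fun f => by rw [← Category.assoc, h₁₂, zero_comp]
  have r₄ : ∀ {Z} (f : X ⟶ Z), i₂ ≫ p₁ ≫ f = 0 := fun f => by rw [← Category.assoc, h₂₁, zero_comp]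
  let e : OnePointExt R M S ≃+* (End T)ᵐᵒᵖ :=
    { toFun := fun x => op (φ x)
      invFun := fun f => ⟨α.symm (i₁ ≫ f.unop ≫ p₁), β.symm (i₁ ≫ f.unop ≫ p₂),
        γ.symm (i₂ ≫ f.unop ≫ p₂)⟩
      left_inv := fun x => by
        have e₁ : i₁ ≫ φ x ≫ p₁ = α x.a := by simp [φ, r₁, h₁, h₂₁]
        have e₂ : i₁ ≫ φ x ≫ p₂ = β x.n := by simp [φ, r₁, r₃, h₂, h₁₂]
        have e₃ : i₂ ≫ φ x ≫ p₂ = γ x.g := by simp [φ, r₂, r₄, h₂]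
        ext
        · exact (congrArg α.symm e₁).trans (α.symm_apply_apply _)
        · exact (congrArg β.symm e₂).trans (β.symm_apply_apply _)
        · exact (congrArg γ.symm e₃).trans (γ.symm_apply_apply _)
      right_inv := fun f => by
        refine MulOpposite.unop_injective ?_
        change p₁ ≫ α (α.symm _) ≫ i₁ + p₁ ≫ β (β.symm _) ≫ i₂ + p₂ ≫ γ (γ.symm _) ≫ i₂ = f.unop
        simp only [AddEquiv.apply_symm_apply]
        -- The fourth block, from `Y` to `X`, is the one without a matrix entry.
        have h0 : p₂ ≫ (i₂ ≫ f.unop ≫ p₁) ≫ i₁ = 0 := by rw [hYX (i₂ ≫ f.unop ≫ p₁)]; simp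
        calc _ = (p₁ ≫ i₁ + p₂ ≫ i₂) ≫ f.unop ≫ (p₁ ≫ i₁ + p₂ ≫ i₂) := by
              simp only [Category.assoc] at h0
              simp only [Preadditive.add_comp, Preadditive.comp_add, Category.assoc, h0]
              abel
          _ = f.unop := by
              rw [hid]
              exact (Category.id_comp _).trans (Category.comp_id _)
      map_mul' := fun x y => by
        refine MulOpposite.unop_injective ?_
        change φ (x * y) = φ x ≫ φ y
        simp [φ, r₁, r₂, r₃, r₄, hα, hγ, hαβ, hβγ]
        abel
      map_add' := fun x y => by
        refine MulOpposite.unop_injective ?_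
        change φ (x + y) = φ x + φ y
        simp [φ]
        abel }
  refine ⟨(AlgEquiv.ofRingEquiv (f := e) fun c => ?_).symm⟩
  refine MulOpposite.unop_injective ?_
  change φ (algebraMap k (OnePointExt R M S) c) = c • 𝟙 T
  have : algebraMap k (OnePointExt R M S) c = ⟨algebraMap k R c, 0, algebraMap k S c⟩ := by
    rw [Algebra.algebraMap_eq_smul_one]
    ext <;> simp [Algebra.algebraMap_eq_smul_one]
  rw [this]
  simp [φ, hαk, hγk, ← hid]

end TriangularEnd

/-! ### Epimorphisms and projective objects among finite-dimensional modules. -/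

namespace FDMod

variable {k : Type w} {A : Type u} [Field k] [Ring A] [Algebra k A]

/-- The underlying linear map of a morphism. -/
def toLin {X Y : FDMod k A} (f : X ⟶ Y) : X.toModule →ₗ[A] Y.toModule := f.hom.hom

/-- A linear map between the underlying modules, as a morphism. -/
def ofLin {X Y : FDMod k A} (f : X.toModule →ₗ[A] Y.toModule) : X ⟶ Y :=
  ObjectProperty.homMk (ModuleCat.ofHom f)

lemma hom_ext {X Y : FDMod k A} {f g : X ⟶ Y} (h : ∀ x, toLin f x = toLin g x) : f = g :=
  ObjectProperty.hom_ext _ (ModuleCat.hom_ext (LinearMap.ext h))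

instance (X : FDMod k A) : Module.Finite A X.toModule := X.property

/-- A linear equivalence between the underlying modules, as an isomorphism. -/
def isoOfLin {X Y : FDMod k A} (e : X.toModule ≃ₗ[A] Y.toModule) : X ≅ Y where
  hom := ofLin e.toLinearMap
  inv := ofLin e.symm.toLinearMap
  hom_inv_id := hom_ext fun x => e.symm_apply_apply x
  inv_hom_id := hom_ext fun x => e.apply_symm_apply x

variable [FiniteDimensional k A]

@[simp] lemma toLin_comp {X Y Z : FDMod k A} (f : X ⟶ Y) (g : Y ⟶ Z) :
    toLin (f ≫ g) = (toLin g).comp (toLin f) := rfl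

@[simp] lemma toLin_zero {X Y : FDMod k A} : toLin (0 : X ⟶ Y) = 0 := rfl

lemma epi_iff_surjective {X Y : FDMod k A} (f : X ⟶ Y) :
    Epi f ↔ Function.Surjective (toLin f) := by
  constructor
  · intro hf
    rw [← LinearMap.range_eq_top]
    let Q : FDMod k A := ofFG k A (Y.toModule ⧸ LinearMap.range (toLin f))
    let g : Y ⟶ Q := ofLin (Submodule.mkQ (LinearMap.range (toLin f)))
    have : g = 0 := (cancel_epi f).1 (hom_ext fun x => by
      have : toLin g (toLin f x) = 0 := (Submodule.Quotient.mk_eq_zero _).2 ⟨x, rfl⟩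
      simpa using this)
    have h : (Submodule.mkQ (LinearMap.range (toLin f))) = 0 := congrArg toLin this
    rw [← Submodule.ker_mkQ (LinearMap.range (toLin f)), h, LinearMap.ker_zero]
  · intro hf
    exact ⟨fun g h e => hom_ext fun y => by
      obtain ⟨x, rfl⟩ := hf y
      exact congrArg (fun l => toLin l x) e⟩

/-- A finite free cover stays inside the category, so a projective object splits off a free module.
-/
lemma projective_iff (X : FDMod k A) : Projective X ↔ Module.Projective A X.toModule := by
  constructor
  · intro _
    obtain ⟨n, g, hg⟩ := Module.Finite.exists_fin' A X.toModule
    let Y : FDMod k A := ofFG k A (Fin n → A)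
    let f : Y ⟶ X := ofLin g
    have : Epi f := (epi_iff_surjective f).2 hg
    have : Module.Projective A Y.toModule := inferInstanceAs (Module.Projective A (Fin n → A))
    exact Module.Projective.of_split (toLin (Projective.factorThru (𝟙 X) f)) (toLin f)
      (congrArg toLin (Projective.factorThru_comp (𝟙 X) f))
  · intro _
    refine ⟨fun {E Y} f e he => ?_⟩
    obtain ⟨h, hh⟩ := Module.projective_lifting_property (toLin e) (toLin f)
      ((epi_iff_surjective e).1 he)
    exact ⟨ofLin h, hom_ext fun x => congrArg (fun l => l x) hh⟩

end FDMod

/-! ### The left ideals `A e₀` and `A e_G`. -/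

namespace OnePointExt

section

variable {A₀ N G : Type u} [Ring A₀] [Ring G] [AddCommGroup N] [Module A₀ N] [Module Gᵐᵒᵖ N]
  [SMulCommClass A₀ Gᵐᵒᵖ N]

lemma a_zero_of_mem_AeG (x : AeG A₀ N G) : x.1.a = 0 := by
  obtain ⟨y, hy⟩ := Ideal.mem_span_singleton'.1 x.2
  rw [← hy]; simp [eG]

lemma mk_mem_AeG (n : N) (g : G) : (⟨0, n, g⟩ : OnePointExt A₀ N G) ∈ AeG A₀ N G :=
  Ideal.mem_span_singleton'.2 ⟨⟨0, n, g⟩, by ext <;> simp [eG]⟩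

lemma n_zero_of_mem_Ae₀ (x : Ae₀ A₀ N G) : x.1.n = 0 := by
  rw [← (mem_Ae₀_iff x.1).1 x.2]; simp [e₀]

lemma g_zero_of_mem_Ae₀ (x : Ae₀ A₀ N G) : x.1.g = 0 := by
  rw [← (mem_Ae₀_iff x.1).1 x.2]; simp [e₀]

lemma mk_mem_Ae₀ (a : A₀) : (⟨a, 0, 0⟩ : OnePointExt A₀ N G) ∈ Ae₀ A₀ N G :=
  (mem_Ae₀_iff _).2 (by ext <;> simp [e₀])

lemma e₀_add_eG : e₀ A₀ N G + eG A₀ N G = 1 := by ext <;> simp [e₀, eG]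

/-- The generator `e_G` of `A e_G`. -/
def genG : AeG A₀ N G := ⟨eG A₀ N G, mk_mem_AeG 0 1⟩

lemma smul_genG (x : AeG A₀ N G) : x.1 • (genG : AeG A₀ N G) = x := by
  refine Subtype.ext ?_
  change x.1 * eG A₀ N G = x.1
  ext <;> simp [eG, a_zero_of_mem_AeG x]

lemma eG_smul_genG : eG A₀ N G • (genG : AeG A₀ N G) = genG := smul_genG genG

instance : Module.Finite (OnePointExt A₀ N G) (Ae₀ A₀ N G) :=
  Module.Finite.span_singleton _ _

instance : Module.Projective (OnePointExt A₀ N G) (AeG A₀ N G) :=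
  Module.Projective.of_split (M := OnePointExt A₀ N G) (AeG A₀ N G).subtype
    (LinearMap.toSpanSingleton _ _ genG) (LinearMap.ext fun x => smul_genG x)

instance : Module.Projective (OnePointExt A₀ N G) (Ae₀ A₀ N G) :=
  Module.Projective.of_split (M := OnePointExt A₀ N G) (Ae₀ A₀ N G).subtype
    (LinearMap.toSpanSingleton _ _ ⟨e₀ A₀ N G, mk_mem_Ae₀ 1⟩)
    (LinearMap.ext fun x => Subtype.ext ((mem_Ae₀_iff x.1).1 x.2))

end

/-! ### The module `A e₀ ⊗_{A₀} X`, identified with `X` inflated along `A → A₀`. -/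

section Tensor

variable {A₀ N G : Type u} [Ring A₀] [Ring G] [AddCommGroup N] [Module A₀ N] [Module Gᵐᵒᵖ N]
  [SMulCommClass A₀ Gᵐᵒᵖ N]
  {X : Type u} [AddCommGroup X] [Module A₀ X]

variable (A₀ N G X) in
/-- The module `A e₀ ⊗_{A₀} X`. -/
abbrev Ind : Type u := BalTensor (OnePointExt A₀ N G) A₀ (Ae₀ A₀ N G) X

/-- The map `x ↦ e₀ ⊗ x`. -/
def toInd : X →+ Ind A₀ N G X where
  toFun x := BalTensor.tmul _ A₀ _ ⟨e₀ A₀ N G, mk_mem_Ae₀ 1⟩ x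
  map_zero' := by simp [BalTensor.tmul]
  map_add' x y := by simp [BalTensor.tmul, TensorProduct.tmul_add]

/-- `X` as a module over the one-point extension, `A` acting through `A → A₀`. -/
def Infl (_A₀ _N _G X : Type u) : Type u := X

instance : AddCommGroup (Infl A₀ N G X) := inferInstanceAs (AddCommGroup X)

instance : Module (OnePointExt A₀ N G) (Infl A₀ N G X) where
  smul r x := (r.a • (show X from x) : X)
  one_smul x := one_smul A₀ (show X from x)
  mul_smul r s x := mul_smul r.a s.a (show X from x)
  smul_zero r := smul_zero (A := X) r.a
  smul_add r x y := smul_add r.a (show X from x) (show X from y)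
  add_smul r s x := add_smul r.a s.a (show X from x)
  zero_smul x := zero_smul A₀ (show X from x)

/-- The map `A e₀ ⊗_{A₀} X → X`, `m ⊗ x ↦ m x`. -/
def indToInfl : Ind A₀ N G X →ₗ[OnePointExt A₀ N G] Infl A₀ N G X :=
  Submodule.liftQ _
    (TensorProduct.AlgebraTensorModule.lift
      { toFun := fun m => (AddMonoidHom.toIntLinearMap
          { toFun := fun x => (m.1.a • x : X)
            map_zero' := smul_zero (A := X) m.1.a
            map_add' := smul_add (A := X) m.1.a } : X →ₗ[ℤ] Infl A₀ N G X)
        map_add' := fun m m' => LinearMap.ext fun x => add_smul m.1.a m'.1.a x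
        map_smul' := fun r m => LinearMap.ext fun x => mul_smul r.a m.1.a x })
    (Submodule.span_le.2 (by
      rintro _ ⟨m, s, x, rfl⟩
      change _ = (0 : Infl A₀ N G X)
      rw [map_sub]
      change ((m.1.a * s) • x : X) - m.1.a • s • x = 0
      rw [mul_smul, sub_self]))

/-- The map `A e₀ ⊗_{A₀} X → X`, `m ⊗ x ↦ m x`. -/
def ofInd (t : Ind A₀ N G X) : X := indToInfl t

lemma ofInd_add (s t : Ind A₀ N G X) : ofInd (s + t) = ofInd s + ofInd t := map_add indToInfl s t

lemma ofInd_smul (r : OnePointExt A₀ N G) (t : Ind A₀ N G X) : ofInd (r • t) = r.a • ofInd t :=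
  indToInfl.map_smul r t

lemma ofInd_tmul (m : Ae₀ A₀ N G) (x : X) :
    ofInd (BalTensor.tmul (OnePointExt A₀ N G) A₀ _ m x) = m.1.a • x := rfl

@[simp] lemma ofInd_toInd (x : X) : ofInd (toInd x : Ind A₀ N G X) = x := one_smul A₀ x

lemma toInd_smul (a : A₀) (x : X) :
    (toInd (a • x) : Ind A₀ N G X) = (⟨a, 0, 0⟩ : OnePointExt A₀ N G) • toInd x := by
  have h : op a • (⟨e₀ A₀ N G, mk_mem_Ae₀ 1⟩ : Ae₀ A₀ N G) =
      (⟨a, 0, 0⟩ : OnePointExt A₀ N G) • ⟨e₀ A₀ N G, mk_mem_Ae₀ 1⟩ := by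
    refine Subtype.ext ?_
    change e₀ A₀ N G * ⟨a, 0, 0⟩ = ⟨a, 0, 0⟩ * e₀ A₀ N G
    ext <;> simp [e₀]
  change BalTensor.tmul _ A₀ _ _ (a • x) = _
  rw [← BalTensor.smul_tmul, h]
  rfl

@[simp] lemma toInd_ofInd (t : Ind A₀ N G X) : toInd (ofInd t) = t := by
  obtain ⟨t, rfl⟩ := Submodule.mkQ_surjective (balancedRel _ _ _ X) t
  induction t with
  | zero =>
    rw [map_zero]
    exact (congrArg (toInd (X := X)) (map_zero indToInfl)).trans (map_zero _)
  | add a b ha hb => rw [map_add, ofInd_add, map_add, ha, hb]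
  | tmul m x =>
    change toInd (ofInd (BalTensor.tmul _ A₀ _ m x)) = BalTensor.tmul _ A₀ _ m x
    rw [ofInd_tmul]
    change BalTensor.tmul _ A₀ _ _ (m.1.a • x) = _
    rw [← BalTensor.smul_tmul]
    congr 1
    refine Subtype.ext ?_
    change e₀ A₀ N G * ⟨m.1.a, 0, 0⟩ = m.1
    ext <;> simp [e₀, n_zero_of_mem_Ae₀, g_zero_of_mem_Ae₀]

lemma smul_toInd (r : OnePointExt A₀ N G) (x : X) :
    r • (toInd x : Ind A₀ N G X) = toInd (r.a • x) := by
  rw [← toInd_ofInd (r • (toInd x : Ind A₀ N G X)), ofInd_smul, ofInd_toInd]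

lemma ofInd_injective : Function.Injective (ofInd : Ind A₀ N G X → X) :=
  Function.LeftInverse.injective toInd_ofInd

lemma ofInd_map {Y : Type u} [AddCommGroup Y] [Module A₀ Y] (f : X →ₗ[A₀] Y) (t : Ind A₀ N G X) :
    ofInd (BalTensor.map _ _ _ f t) = f (ofInd t) := by
  rw [← toInd_ofInd t, ofInd_toInd]
  exact ofInd_toInd (N := N) (G := G) (f (ofInd t))

lemma eG_smul_ind (t : Ind A₀ N G X) : eG A₀ N G • t = 0 := by
  rw [← toInd_ofInd t, smul_toInd]
  simp [eG]

/-- A section of the free cover of `X` is pushed along `a ↦ (a 0; 0 0)`. It stays linear over `A`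
because `r (a 0; 0 0)` depends only on the upper left entry of `r`. -/
instance [Module.Projective A₀ X] : Module.Projective (OnePointExt A₀ N G) (Ind A₀ N G X) := by
  obtain ⟨s, hs⟩ := Module.projective_def'.1 ‹Module.Projective A₀ X›
  let j : A₀ →+ OnePointExt A₀ N G :=
    { toFun := fun a => ⟨a, 0, 0⟩
      map_zero' := rfl
      map_add' := fun a b => by ext <;> simp }
  let i : Ind A₀ N G X →ₗ[OnePointExt A₀ N G] (X →₀ OnePointExt A₀ N G) :=
    { toFun := fun t => Finsupp.mapRange.addMonoidHom j (s (ofInd t))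
      map_add' := fun t t' => by rw [ofInd_add, map_add, map_add]
      map_smul' := fun r t => by
        rw [ofInd_smul, s.map_smul]
        ext1 x
        simp only [Finsupp.mapRange.addMonoidHom_apply, Finsupp.mapRange_apply, RingHom.id_apply,
          Finsupp.coe_smul, Pi.smul_apply]
        ext <;> simp [j] }
  let p := Finsupp.linearCombination (OnePointExt A₀ N G) (toInd : X → Ind A₀ N G X)
  have hp : ∀ v : X →₀ A₀, p (Finsupp.mapRange.addMonoidHom j v) =
      toInd (Finsupp.linearCombination A₀ id v) := fun v => by
    induction v using Finsupp.induction_linear with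
    | zero => simp
    | add v w hv hw => rw [map_add, map_add, hv, hw, map_add, map_add]
    | single x a =>
      simp only [Finsupp.mapRange.addMonoidHom_apply, Finsupp.mapRange_single, p,
        Finsupp.linearCombination_single, smul_toInd, id, j]
      rfl
  refine Module.Projective.of_split i p (LinearMap.ext fun t => ?_)
  exact (hp _).trans ((congrArg toInd (congrArg (fun l => l (ofInd t)) hs)).trans (toInd_ofInd t))

end Tensor

end OnePointExt

/-! ### Linear maps between the modules `A e₀ ⊗ X` and `A e_G`. -/

namespace OnePointExt

section Lin

variable {A₀ N G : Type u} [Ring A₀] [Ring G] [AddCommGroup N] [Module A₀ N] [Module Gᵐᵒᵖ N]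
  [SMulCommClass A₀ Gᵐᵒᵖ N]
  {X Y : Type u} [AddCommGroup X] [Module A₀ X] [AddCommGroup Y] [Module A₀ Y]

variable (N G) in
/-- The map `A e₀ ⊗ f`. -/
abbrev indMap (f : X →ₗ[A₀] Y) : Ind A₀ N G X →ₗ[OnePointExt A₀ N G] Ind A₀ N G Y :=
  BalTensor.map (OnePointExt A₀ N G) A₀ (Ae₀ A₀ N G) f

lemma indMap_bijective : Function.Bijective (indMap (A₀ := A₀) N G (X := X) (Y := Y)) := by
  refine ⟨fun f g h => LinearMap.ext fun x => ?_, fun h => ?_⟩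
  · have := congrArg (fun l => ofInd (l (toInd x))) h
    simpa only [ofInd_map, ofInd_toInd] using this
  · refine ⟨{ toFun := fun x => ofInd (h (toInd x))
              map_add' := fun x y => by rw [map_add, map_add, ofInd_add]
              map_smul' := fun r x => by rw [toInd_smul, h.map_smul, ofInd_smul]; rfl }, ?_⟩
    refine LinearMap.ext fun t => ofInd_injective ?_
    rw [ofInd_map]
    change ofInd (h (toInd (ofInd t))) = _
    rw [toInd_ofInd]

lemma ofInd_algebraMap_smul {k : Type w} [Field k] [Algebra k A₀] [Algebra k G] [Module k N]
    [IsScalarTower k A₀ N] [IsScalarTower k Gᵐᵒᵖ N] (c : k) (t : Ind A₀ N G X) :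
    ofInd (algebraMap k (OnePointExt A₀ N G) c • t) = algebraMap k A₀ c • ofInd t := by
  rw [ofInd_smul, Algebra.algebraMap_eq_smul_one, Algebra.algebraMap_eq_smul_one]
  rfl

variable (A₀ N G) in
/-- The inclusion of `A e₀ ⊗_{A₀} N = e₀ A e_G` into `A e_G`. -/
def inclLin : Ind A₀ N G N →ₗ[OnePointExt A₀ N G] AeG A₀ N G where
  toFun t := ⟨⟨0, ofInd t, 0⟩, mk_mem_AeG _ _⟩
  map_add' s t := Subtype.ext (by rw [ofInd_add]; ext <;> simp)
  map_smul' r t := Subtype.ext (by rw [ofInd_smul]; ext <;> simp)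

lemma inclLin_apply (t : Ind A₀ N G N) :
    (inclLin A₀ N G t : OnePointExt A₀ N G) = ⟨0, ofInd t, 0⟩ := rfl

/-- Since `e₀` fixes `e₀ ⊗ x`, any linear map sends it into `e₀ A e_G = N`. Its upper right entry
recovers the map `X → N`. -/
lemma inclLin_comp_bijective :
    Function.Bijective (fun f : X →ₗ[A₀] N => (inclLin A₀ N G) ∘ₗ indMap N G f) := by
  refine ⟨fun f g h => LinearMap.ext fun x => ?_, fun h => ?_⟩
  · have := congrArg (fun l => (l (toInd x)).1.n) h
    simpa only [LinearMap.comp_apply, inclLin_apply, ofInd_map, ofInd_toInd] using this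
  · refine ⟨{ toFun := fun x => (h (toInd x)).1.n
              map_add' := fun x y => by rw [map_add, map_add]; rfl
              map_smul' := fun r x => by
                rw [toInd_smul, h.map_smul]
                simp }, LinearMap.ext fun t => Subtype.ext ?_⟩
    rw [← toInd_ofInd t]
    generalize ofInd t = x
    rw [LinearMap.comp_apply, inclLin_apply, ofInd_map, ofInd_toInd]
    have e : e₀ A₀ N G • h (toInd x) = h (toInd x) := by
      rw [← h.map_smul, smul_toInd]; simp [e₀]
    have e' : e₀ A₀ N G * (h (toInd x)).1 = (h (toInd x)).1 := congrArg Subtype.val e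
    ext
    · exact (a_zero_of_mem_AeG _).symm
    · rfl
    · rw [← e']; simp [e₀]

/-- The generator is fixed by `e_G`, which kills the target. -/
lemma AeG_hom_ind_eq_zero (f : AeG A₀ N G →ₗ[OnePointExt A₀ N G] Ind A₀ N G X) : f = 0 :=
  LinearMap.ext fun x => by
    rw [← smul_genG x, ← eG_smul_genG, f.map_smul, f.map_smul, eG_smul_ind, smul_zero]; rfl

variable (A₀ N) in
/-- Right multiplication by `g` on `A e_G`. -/
def mulLin (g : G) : AeG A₀ N G →ₗ[OnePointExt A₀ N G] AeG A₀ N G where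
  toFun x := ⟨x.1 * ⟨0, 0, g⟩, by
    rw [show x.1 * ⟨0, 0, g⟩ = (⟨0, op g • x.1.n, x.1.g * g⟩ : OnePointExt A₀ N G) by
      ext <;> simp]
    exact mk_mem_AeG _ _⟩
  map_add' x y := Subtype.ext (add_mul x.1 y.1 _)
  map_smul' r x := Subtype.ext (mul_assoc r x.1 _)

lemma mulLin_apply (g : G) (x : AeG A₀ N G) :
    (mulLin A₀ N g x : OnePointExt A₀ N G) = x.1 * ⟨0, 0, g⟩ := rfl

/-- An endomorphism is determined by the image of `e_G`, which lies in `e_G A e_G = G`. -/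
lemma mulLin_bijective : Function.Bijective (mulLin A₀ N (G := G)) := by
  refine ⟨fun g h e => ?_, fun f => ?_⟩
  · have e' : eG A₀ N G * ⟨0, 0, g⟩ = eG A₀ N G * ⟨0, 0, h⟩ :=
      congrArg (fun l => (l genG).1) e
    simpa [eG] using congrArg OnePointExt.g e'
  · refine ⟨(f genG).1.g, LinearMap.ext fun x => Subtype.ext ?_⟩
    have h : (f genG).1 = ⟨0, 0, (f genG).1.g⟩ := by
      have : eG A₀ N G * (f genG).1 = (f genG).1 :=
        congrArg Subtype.val ((f.map_smul (eG A₀ N G) genG).symm.trans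
          (congrArg f eG_smul_genG))
      rw [← this]; ext <;> simp [eG]
    rw [mulLin_apply, ← h]
    conv_rhs => rw [← smul_genG x, f.map_smul]
    rfl

end Lin

end OnePointExt

/-! ### The same facts for the functor `A e₀ ⊗_{A₀} -` on module categories. -/

section Functor

open OnePointExt

variable (k : Type w) [Field k] {A₀ : Type u} [Ring A₀] [Algebra k A₀] [FiniteDimensional k A₀]
  (N G : Type u) [Ring G] [Algebra k G] [FiniteDimensional k G]
  [AddCommGroup N] [Module k N] [FiniteDimensional k N] [Module A₀ N] [Module Gᵐᵒᵖ N]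
  [SMulCommClass A₀ Gᵐᵒᵖ N] [IsScalarTower k A₀ N] [IsScalarTower k Gᵐᵒᵖ N]

/-- The functor `A e₀ ⊗_{A₀} -`. -/
abbrev indFunctor : FDMod k A₀ ⥤ FDMod k (OnePointExt A₀ N G) :=
  tensorFunctor k (OnePointExt A₀ N G) A₀ (Ae₀ A₀ N G)

/-- The module `A e_G`. -/
abbrev objG : FDMod k (OnePointExt A₀ N G) := FDMod.ofFG k _ (AeG A₀ N G)

/-- The inclusion of `A e₀ ⊗_{A₀} N = e₀ A e_G` into `A e_G`. -/
def inclN : (indFunctor k N G).obj (FDMod.of k A₀ N) ⟶ objG k N G :=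
  FDMod.ofLin (X := (indFunctor k N G).obj (FDMod.of k A₀ N)) (Y := objG k N G) (inclLin A₀ N G)

/-- Right multiplication by `g` on `A e_G`. -/
def mulG (g : G) : objG k N G ⟶ objG (A₀ := A₀) k N G :=
  FDMod.ofLin (X := objG k N G) (Y := objG k N G) (mulLin A₀ N g)

variable {N G}

instance : (indFunctor (A₀ := A₀) k N G).Faithful where
  map_injective {_ _ f g} h :=
    congrArg FDMod.ofLin (indMap_bijective.1 (a₁ := FDMod.toLin f) (a₂ := FDMod.toLin g)
      (congrArg FDMod.toLin h))

instance : (indFunctor (A₀ := A₀) k N G).Full where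
  map_surjective h := by
    obtain ⟨f, hf⟩ := indMap_bijective.2 (FDMod.toLin h)
    exact ⟨FDMod.ofLin f, congrArg FDMod.ofLin hf⟩

instance : (indFunctor (A₀ := A₀) k N G).Linear k where
  map_smul f c := by
    have h : indMap N G (FDMod.toLin (c • f)) = FDMod.toLin (c • (indFunctor k N G).map f) :=
      LinearMap.ext fun t => ofInd_injective (by
        refine (ofInd_map _ _).trans ?_
        refine Eq.trans ?_ (ofInd_algebraMap_smul c (indMap N G (FDMod.toLin f) t)).symm
        exact congrArg _ (ofInd_map (FDMod.toLin f) t).symm)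
    exact congrArg FDMod.ofLin h

lemma isCoreflection_inclN : IsCoreflection (indFunctor k N G) (inclN (A₀ := A₀) k N G) := by
  intro X
  refine ⟨fun f g h => ?_, fun h => ?_⟩
  · let f' : X.toModule →ₗ[A₀] N := FDMod.toLin f
    let g' : X.toModule →ₗ[A₀] N := FDMod.toLin g
    have h' : inclLin A₀ N G ∘ₗ indMap N G f' = inclLin A₀ N G ∘ₗ indMap N G g' :=
      congrArg FDMod.toLin h
    have e : f' = g' := inclLin_comp_bijective.1 h'
    exact congrArg (FDMod.ofLin (Y := FDMod.of k A₀ N)) e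
  · obtain ⟨f, hf⟩ := inclLin_comp_bijective.2 (FDMod.toLin h)
    exact ⟨FDMod.ofLin (Y := FDMod.of k A₀ N) f, congrArg FDMod.ofLin hf⟩

lemma objG_hom_ind_eq_zero {X : FDMod k A₀} (f : objG k N G ⟶ (indFunctor k N G).obj X) :
    f = 0 :=
  congrArg FDMod.ofLin (AeG_hom_ind_eq_zero (FDMod.toLin f))

/-- This matches the right action of `G` on `N` with the endomorphisms of `A e_G`; it becomes the
right action on the off-diagonal entry of the endomorphism algebra. -/
lemma inclN_comp_mulG (g : G) :
    inclN k N G ≫ mulG k N G g =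
      (indFunctor k N G).map (FDMod.ofHom (rightMul g : N →ₗ[A₀] N)) ≫ inclN k N G := by
  have h : mulLin A₀ N g ∘ₗ inclLin A₀ N G =
      inclLin A₀ N G ∘ₗ indMap N G (rightMul g : N →ₗ[A₀] N) :=
    LinearMap.ext fun t => Subtype.ext (by
      simp only [LinearMap.comp_apply, inclLin_apply, mulLin_apply, ofInd_map]
      ext <;> simp [rightMul])
  exact congrArg FDMod.ofLin h

lemma mulG_mul (g h : G) : mulG (A₀ := A₀) k N G (g * h) = mulG k N G g ≫ mulG k N G h := by
  have : mulLin A₀ N (g * h) = mulLin A₀ N h ∘ₗ mulLin A₀ N g :=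
    LinearMap.ext fun x => Subtype.ext (by
      simp only [LinearMap.comp_apply, mulLin_apply, mul_assoc]; congr 1; ext <;> simp)
  exact congrArg FDMod.ofLin this

lemma mulG_add (g h : G) : mulG (A₀ := A₀) k N G (g + h) = mulG k N G g + mulG k N G h := by
  have : mulLin A₀ N (g + h) = mulLin A₀ N g + mulLin A₀ N h :=
    LinearMap.ext fun x => Subtype.ext (by
      simp only [LinearMap.add_apply, Submodule.coe_add, mulLin_apply, ← mul_add]
      congr 1; ext <;> simp)
  exact congrArg FDMod.ofLin this

lemma mulG_algebraMap (c : k) :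
    mulG (A₀ := A₀) k N G (algebraMap k G c) = c • 𝟙 (objG k N G) := by
  refine FDMod.hom_ext fun x : AeG A₀ N G => Subtype.ext ?_
  change x.1 * ⟨0, 0, algebraMap k G c⟩ = algebraMap k (OnePointExt A₀ N G) c * x.1
  rw [← Algebra.smul_def, Algebra.algebraMap_eq_smul_one]
  ext <;> simp [a_zero_of_mem_AeG x]

lemma mulG_bijective : Function.Bijective (mulG (A₀ := A₀) k N G) := by
  refine ⟨fun g h e => mulLin_bijective.1 (congrArg FDMod.toLin e), fun f => ?_⟩
  obtain ⟨g, hg⟩ := mulLin_bijective.2 (FDMod.toLin f)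
  exact ⟨g, congrArg FDMod.ofLin hg⟩

/-- Right multiplications exhaust the endomorphisms of `A e_G`. -/
def mulGEquiv : G ≃+ (objG (A₀ := A₀) k N G ⟶ objG k N G) :=
  { Equiv.ofBijective _ (mulG_bijective k) with map_add' := mulG_add k }

instance {X : FDMod k A₀} [Module.Projective A₀ X.toModule] :
    Module.Projective (OnePointExt A₀ N G) ((indFunctor k N G).obj X).toModule :=
  inferInstanceAs (Module.Projective (OnePointExt A₀ N G) (Ind A₀ N G X.toModule))

instance : Module.Projective (OnePointExt A₀ N G) (objG (A₀ := A₀) k N G).toModule :=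
  inferInstanceAs (Module.Projective (OnePointExt A₀ N G) (AeG A₀ N G))

end Functor

/-! ### Bounded complexes of projectives and the closure `add(T)`. -/

section BoundedProj

variable {k : Type w} [Field k] {A : Type u} [Ring A] [Algebra k A] [FiniteDimensional k A]

lemma isBoundedProj_single (M : FDMod k A) [Module.Projective A M.toModule] :
    isBoundedProj k A ((HomotopyCategory.singleFunctor _ 0).obj M) := by
  refine ⟨⟨0, inferInstanceAs
      (CochainComplex.IsStrictlyGE ((CochainComplex.singleFunctor (FDMod k A) 0).obj M) 0)⟩,
    ⟨0, inferInstanceAs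
      (CochainComplex.IsStrictlyLE ((CochainComplex.singleFunctor (FDMod k A) 0).obj M) 0)⟩,
    fun i => ?_⟩
  rw [← FDMod.projective_iff]
  by_cases hi : i = 0
  · subst hi
    exact Projective.of_iso (HomologicalComplex.singleObjXSelf (.up ℤ) 0 M).symm
      ((FDMod.projective_iff M).2 inferInstance)
  · exact Projective.of_iso
      (HomologicalComplex.isZero_single_obj_X (.up ℤ) 0 M i hi).isoZero.symm inferInstance

lemma isBoundedProj_biprod (K L : CochainComplex (FDMod k A) ℤ)
    (hK : isBoundedProj k A ((HomotopyCategory.quotient _ _).obj K))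
    (hL : isBoundedProj k A ((HomotopyCategory.quotient _ _).obj L)) :
    isBoundedProj k A ((HomotopyCategory.quotient _ _).obj (K ⊞ L)) := by
  obtain ⟨⟨p, hp⟩, ⟨q, hq⟩, h⟩ := hK
  obtain ⟨⟨p', hp'⟩, ⟨q', hq'⟩, h'⟩ := hL
  change ∀ i, Module.Projective A (FDMod.toModule (K.X i)) at h
  change ∀ i, Module.Projective A (FDMod.toModule (L.X i)) at h'
  change K.IsStrictlyGE p at hp
  change K.IsStrictlyLE q at hq
  change L.IsStrictlyGE p' at hp'
  change L.IsStrictlyLE q' at hq'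
  have e : ∀ i, (K ⊞ L).X i ≅ K.X i ⊞ L.X i := fun i => HomologicalComplex.biprodXIso K L i
  have hz : ∀ i, IsZero (K.X i) → IsZero (L.X i) → IsZero ((K ⊞ L).X i) := fun i a b =>
    ((biprod_isZero_iff _ _).2 ⟨a, b⟩).of_iso (e i)
  refine ⟨⟨min p p', ?_⟩, ⟨max q q', ?_⟩, fun i => ?_⟩
  · change CochainComplex.IsStrictlyGE (K ⊞ L) _
    rw [CochainComplex.isStrictlyGE_iff]
    intro i hi
    exact hz i (K.isZero_of_isStrictlyGE p i (by lia)) (L.isZero_of_isStrictlyGE p' i (by lia))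
  · change CochainComplex.IsStrictlyLE (K ⊞ L) _
    rw [CochainComplex.isStrictlyLE_iff]
    intro i hi
    exact hz i (K.isZero_of_isStrictlyLE q i (by lia)) (L.isZero_of_isStrictlyLE q' i (by lia))
  · rw [← FDMod.projective_iff]
    have := (FDMod.projective_iff _).2 (h i)
    have := (FDMod.projective_iff _).2 (h' i)
    exact Projective.of_iso (e i).symm inferInstance

/-- `add(T)` in terms of partitions of the identity. -/
lemma addClosure_iff (T X : KbProj k A) :
    addClosure T X ↔ ∃ (n : ℕ) (f : Fin n → (X ⟶ T)) (g : Fin n → (T ⟶ X)),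
      ∑ j, f j ≫ g j = 𝟙 X := by
  constructor
  · rintro ⟨n, b, ⟨hb⟩, ⟨r⟩⟩
    refine ⟨n, fun j => r.i ≫ b.π j, fun j => b.ι j ≫ r.r, ?_⟩
    calc _ = r.i ≫ (∑ j, b.π j ≫ b.ι j) ≫ r.r := by
          simp [Preadditive.sum_comp, Preadditive.comp_sum]
      _ = 𝟙 X := by rw [IsBilimit.total hb]; simp
  · rintro ⟨n, f, g, h⟩
    have : HasFiniteBiproducts (KbProj k A) := HasFiniteBiproducts.of_hasFiniteProducts
    refine ⟨n, biproduct.bicone _, ⟨biproduct.isBilimit _⟩,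
      ⟨⟨biproduct.lift f, biproduct.desc g, ?_⟩⟩⟩
    rw [biproduct.lift_desc, h]

/-- A partition of the identity through `T` is carried to one through `Ψ T`, and then to one through
`T'`, of which `Ψ T` is a retract. -/
lemma addClosure_map {A' : Type u} [Ring A'] [Algebra k A'] [FiniteDimensional k A']
    (Ψ : KbProj k A ⥤ KbProj k A') [Ψ.Additive] {T X : KbProj k A} {T' : KbProj k A'}
    (i : Ψ.obj T ⟶ T') (p : T' ⟶ Ψ.obj T) (h : i ≫ p = 𝟙 _) (hX : addClosure T X) :
    addClosure T' (Ψ.obj X) := by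
  rw [addClosure_iff] at hX ⊢
  obtain ⟨n, f, g, hfg⟩ := hX
  refine ⟨n, fun j => Ψ.map (f j) ≫ i, fun j => p ≫ Ψ.map (g j), ?_⟩
  simp only [Category.assoc, reassoc_of% h, ← Functor.map_comp, ← Functor.map_sum, hfg]
  exact Ψ.map_id X

end BoundedProj

/-! ### Projective modules over the one-point extension. -/

namespace OnePointExt

section Modules

variable {A₀ N G : Type u} [Ring A₀] [AddCommGroup N] [Module A₀ N]
  {Q : Type u} [AddCommGroup Q]

section

variable [Ring G] [Module Gᵐᵒᵖ N] [SMulCommClass A₀ Gᵐᵒᵖ N] [Module (OnePointExt A₀ N G) Q]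

/-- A module killed by `e_G` is a module over `A₀`. -/
abbrev moduleOfKilled (h : ∀ x : Q, eG A₀ N G • x = 0) : Module A₀ Q where
  smul a x := (⟨a, 0, 0⟩ : OnePointExt A₀ N G) • x
  one_smul x := by
    change (⟨1, 0, 0⟩ : OnePointExt A₀ N G) • x = x
    have : (e₀ A₀ N G + eG A₀ N G) • x = x := by rw [e₀_add_eG, one_smul]
    rwa [add_smul, h, add_zero] at this
  mul_smul a b x := by
    change (⟨a * b, 0, 0⟩ : OnePointExt A₀ N G) • x =
      (⟨a, 0, 0⟩ : OnePointExt A₀ N G) • (⟨b, 0, 0⟩ : OnePointExt A₀ N G) • x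
    rw [← mul_smul]; congr 1; ext <;> simp
  smul_zero a := smul_zero (⟨a, 0, 0⟩ : OnePointExt A₀ N G)
  smul_add a := smul_add (⟨a, 0, 0⟩ : OnePointExt A₀ N G)
  add_smul a b x := by
    change (⟨a + b, 0, 0⟩ : OnePointExt A₀ N G) • x =
      (⟨a, 0, 0⟩ : OnePointExt A₀ N G) • x + (⟨b, 0, 0⟩ : OnePointExt A₀ N G) • x
    rw [← add_smul]; congr 1; ext <;> simp
  zero_smul x := zero_smul (OnePointExt A₀ N G) x

lemma smul_eq_of_killed (h : ∀ x : Q, eG A₀ N G • x = 0) (r : OnePointExt A₀ N G) (x : Q) :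
    r • x = (⟨r.a, 0, 0⟩ : OnePointExt A₀ N G) • x := by
  have hr : r = ⟨r.a, 0, 0⟩ + (⟨0, r.n, r.g⟩ : OnePointExt A₀ N G) * eG A₀ N G := by
    ext <;> simp [eG]
  conv_lhs => rw [hr, add_smul, mul_smul, h, smul_zero, add_zero]

/-- Here `A` acts through the ring map `A → A₀`. The same generators therefore work over `A₀`, and a
section of the free cover over `A` is pushed forward to one over `A₀`. -/
lemma exists_indEquiv_of_killed (h : ∀ x : Q, eG A₀ N G • x = 0)
    [Module.Finite (OnePointExt A₀ N G) Q] [Module.Projective (OnePointExt A₀ N G) Q] :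
    let _ := moduleOfKilled h
    Module.Finite A₀ Q ∧ Module.Projective A₀ Q ∧
      Nonempty (Ind A₀ N G Q ≃ₗ[OnePointExt A₀ N G] Q) := by
  let _ := moduleOfKilled h
  have hs : ∀ (r : OnePointExt A₀ N G) (x : Q), r • x = r.a • x := smul_eq_of_killed h
  refine ⟨?_, ?_, ⟨⟨⟨⟨ofInd, ofInd_add⟩, fun r t => ?_⟩, toInd, toInd_ofInd, ofInd_toInd⟩⟩⟩
  · obtain ⟨S, hS⟩ := Module.Finite.fg_top (R := OnePointExt A₀ N G) (M := Q)
    refine ⟨⟨S, eq_top_iff.2 fun x _ => ?_⟩⟩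
    have hx : x ∈ Submodule.span (OnePointExt A₀ N G) (S : Set Q) := hS ▸ Submodule.mem_top
    induction hx using Submodule.span_induction with
    | mem y hy => exact Submodule.subset_span hy
    | zero => exact Submodule.zero_mem _
    | add y z _ _ hy hz => exact Submodule.add_mem _ (hy trivial) (hz trivial)
    | smul r y _ hy => rw [hs]; exact Submodule.smul_mem _ _ (hy trivial)
  · obtain ⟨s, hsec⟩ := Module.projective_def'.1 ‹Module.Projective (OnePointExt A₀ N G) Q›
    let j : OnePointExt A₀ N G →+ A₀ := ⟨⟨OnePointExt.a, rfl⟩, add_a⟩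
    refine Module.projective_def'.2 ⟨⟨⟨fun x => Finsupp.mapRange.addMonoidHom j (s x),
      fun x y => by rw [map_add, map_add]⟩, fun a x => ?_⟩, LinearMap.ext fun x => ?_⟩
    · change Finsupp.mapRange.addMonoidHom j (s ((⟨a, 0, 0⟩ : OnePointExt A₀ N G) • x)) = _
      rw [s.map_smul]
      ext y
      simp [j]
    · have hv : ∀ v : Q →₀ OnePointExt A₀ N G,
          Finsupp.linearCombination A₀ id (Finsupp.mapRange.addMonoidHom j v) =
            Finsupp.linearCombination (OnePointExt A₀ N G) id v := fun v => by
        induction v using Finsupp.induction_linear with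
        | zero => simp
        | add v w hv hw => rw [map_add, map_add, hv, hw, map_add]
        | single x a =>
          simp only [Finsupp.mapRange.addMonoidHom_apply, Finsupp.mapRange_single,
            Finsupp.linearCombination_single, hs a, id, j]
          rfl
      exact (hv (s x)).trans (congrArg (fun l => l x) hsec)
  · exact (ofInd_smul r t).trans (hs r _).symm

end

/-- A projective module not killed by `e_G` has `A e_G` as a quotient. -/
lemma exists_surjective_AeG [DivisionRing G] [Module Gᵐᵒᵖ N] [SMulCommClass A₀ Gᵐᵒᵖ N]
    [Module (OnePointExt A₀ N G) Q] [Module.Projective (OnePointExt A₀ N G) Q] {q : Q}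
    (hq : eG A₀ N G • q ≠ 0) :
    ∃ f : Q →ₗ[OnePointExt A₀ N G] AeG A₀ N G, Function.Surjective f := by
  obtain ⟨s, hs⟩ := Module.projective_def'.1 ‹Module.Projective (OnePointExt A₀ N G) Q›
  have hsq : s (eG A₀ N G • q) ≠ 0 := fun h0 => hq (by
    have := congrArg (fun l => l (eG A₀ N G • q)) hs
    rw [LinearMap.comp_apply, h0, map_zero] at this
    exact this.symm)
  obtain ⟨y, hy⟩ := Finsupp.ne_iff.1 hsq
  -- Left multiplication by `e_G` keeps only the lower right entry.
  have hg : (s q y).g ≠ 0 := fun h0 => hy (by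
    rw [s.map_smul]
    ext <;> simp [eG, h0])
  -- The map takes the coordinate at `y` and multiplies by `e_G` on the right. The lower right entry
  -- of that coordinate of `q` is invertible in the division ring `G`, so a suitable multiple of `q`
  -- hits any `x`.
  refine ⟨(LinearMap.toSpanSingleton (OnePointExt A₀ N G) _ genG) ∘ₗ Finsupp.lapply y ∘ₗ s,
    fun x => ⟨(x.1 * ⟨0, 0, (s q y).g⁻¹⟩) • q, Subtype.ext ?_⟩⟩
  simp only [LinearMap.comp_apply, s.map_smul, Finsupp.lapply_apply,
    LinearMap.toSpanSingleton_apply, Finsupp.smul_apply]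
  change x.1 * ⟨0, 0, (s q y).g⁻¹⟩ * s q y * eG A₀ N G = x.1
  ext
  · simp [a_zero_of_mem_AeG x]
  · simp [eG, smul_smul, hg]
  · simp [eG, hg]

end Modules

end OnePointExt

/-! ### Generation of the homotopy category by the summands of `T`. -/

section Generation

open OnePointExt

variable (k : Type w) [Field k] {A₀ : Type u} [Ring A₀] [Algebra k A₀] [FiniteDimensional k A₀]
  (N G : Type u) [DivisionRing G] [Algebra k G] [FiniteDimensional k G]
  [AddCommGroup N] [Module k N] [FiniteDimensional k N] [Module A₀ N] [Module Gᵐᵒᵖ N]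
  [SMulCommClass A₀ Gᵐᵒᵖ N] [IsScalarTower k A₀ N] [IsScalarTower k Gᵐᵒᵖ N]

variable {N G} in
-- As long as `e_G` acts nontrivially, a copy of `A e_G` splits off. What remains at the end is
-- killed by `e_G`, hence of the form `A e₀ ⊗ X` with `X` projective.
lemma prop_single_of_projective
    (P : ObjectProperty (HomotopyCategory (FDMod k (OnePointExt A₀ N G)) (.up ℤ)))
    [P.IsTriangulated] [P.IsClosedUnderIsomorphisms]
    (h₀ : ∀ X : FDMod k A₀, Module.Projective A₀ X.toModule →
      P ((HomotopyCategory.singleFunctor _ 0).obj ((indFunctor k N G).obj X)))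
    (hG : P ((HomotopyCategory.singleFunctor _ 0).obj (objG k N G)))
    (Q : FDMod k (OnePointExt A₀ N G)) (hQ : Module.Projective (OnePointExt A₀ N G) Q.toModule) :
    P ((HomotopyCategory.singleFunctor _ 0).obj Q) := by
  have : IsNoetherianRing (OnePointExt A₀ N G) := IsNoetherianRing.of_finite k _
  have : IsArtinianRing (OnePointExt A₀ N G) := IsArtinianRing.of_finite k _
  have iso : ∀ {X Y : FDMod k (OnePointExt A₀ N G)}, (X ≅ Y) →
      P ((HomotopyCategory.singleFunctor _ 0).obj X) →
      P ((HomotopyCategory.singleFunctor _ 0).obj Y) := fun e h =>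
    P.prop_of_iso ((HomotopyCategory.singleFunctor _ 0).mapIso e) h
  have key : ∀ S : Submodule (OnePointExt A₀ N G) Q.toModule,
      Module.Projective (OnePointExt A₀ N G) S →
      P ((HomotopyCategory.singleFunctor _ 0).obj (FDMod.ofFG k _ S)) := by
    intro S
    -- Strict inclusion of submodules of `Q` is well founded, as `A` is artinian. The kernels that
    -- occur are regarded as submodules of the fixed module `Q`.
    induction S using WellFoundedLT.induction with
    | ind S ih =>
    intro hS
    by_cases h : ∀ x : S, eG A₀ N G • x = 0
    · let _ := moduleOfKilled h
      obtain ⟨_, hproj, ⟨e⟩⟩ := exists_indEquiv_of_killed h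
      exact iso (FDMod.isoOfLin (X := (indFunctor k N G).obj (FDMod.ofFG k A₀ S))
        (Y := FDMod.ofFG k _ S) e) (h₀ (FDMod.ofFG k A₀ S) hproj)
    · push Not at h
      obtain ⟨q, hq⟩ := h
      obtain ⟨f, hf⟩ := exists_surjective_AeG hq
      obtain ⟨s, hs⟩ := Module.projective_lifting_property f LinearMap.id hf
      have hs' : ∀ x, f (s x) = x := fun x => congrArg (fun l => l x) hs
      let r : S →ₗ[OnePointExt A₀ N G] LinearMap.ker f :=
        LinearMap.codRestrict _ (LinearMap.id - s ∘ₗ f) (fun x => by simp [hs'])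
      have hr : r ∘ₗ (LinearMap.ker f).subtype = LinearMap.id := LinearMap.ext fun x =>
        Subtype.ext (by simp [r])
      have hker : Module.Projective (OnePointExt A₀ N G) (LinearMap.ker f) :=
        Module.Projective.of_split (LinearMap.ker f).subtype r hr
      let e := Submodule.equivSubtypeMap S (LinearMap.ker f)
      have hlt : (LinearMap.ker f).map S.subtype < S := by
        refine lt_of_le_of_ne (Submodule.map_subtype_le _ _) fun heq => ?_
        obtain ⟨x, hx⟩ := hf genG
        have hxS : (x : Q.toModule) ∈ (LinearMap.ker f).map S.subtype := by
          rw [heq]; exact x.2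
        obtain ⟨y, hy, hyx⟩ := hxS
        obtain rfl : y = x := Subtype.ext hyx
        rw [SetLike.mem_coe, LinearMap.mem_ker, hx] at hy
        exact one_ne_zero (congrArg (fun z : AeG A₀ N G => z.1.g) hy)
      have h₁ := iso (FDMod.isoOfLin (X := FDMod.ofFG k _ _)
        (Y := FDMod.ofFG k _ (LinearMap.ker f)) e.symm) (ih _ hlt (Module.Projective.of_equiv e))
      let C : ShortComplex (FDMod k (OnePointExt A₀ N G)) :=
        { X₁ := FDMod.ofFG k _ (LinearMap.ker f)
          X₂ := FDMod.ofFG k _ S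
          X₃ := objG k N G
          f := FDMod.ofLin (X := FDMod.ofFG k _ (LinearMap.ker f)) (Y := FDMod.ofFG k _ S)
            (LinearMap.ker f).subtype
          g := FDMod.ofLin (X := FDMod.ofFG k _ S) (Y := objG k N G) f
          zero := FDMod.hom_ext fun x => x.2 }
      let σ : C.Splitting :=
        { r := FDMod.ofLin (X := FDMod.ofFG k _ S) (Y := FDMod.ofFG k _ (LinearMap.ker f)) r
          s := FDMod.ofLin (X := objG k N G) (Y := FDMod.ofFG k _ S) s
          f_r := congrArg FDMod.ofLin hr
          s_g := congrArg FDMod.ofLin hs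
          id := FDMod.hom_ext fun x => by
            exact sub_add_cancel (x : S) (s (f x)) }
      exact prop_single_of_splitting P C σ h₁ hG
  have e := Submodule.topEquiv (R := OnePointExt A₀ N G) (M := Q.toModule)
  exact iso (FDMod.isoOfLin (X := FDMod.ofFG k _ _) (Y := Q) e)
    (key ⊤ (Module.Projective.of_equiv e.symm))

/-- The functor `A e₀ ⊗_{A₀} -` on bounded complexes of projectives. -/
def indKb : KbProj k A₀ ⥤ KbProj k (OnePointExt A₀ N G) :=
  ObjectProperty.lift _ ((isBoundedProj k A₀).ι ⋙ (indFunctor k N G).mapHomotopyCategory (.up ℤ))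
    (by
      rintro ⟨K, hK⟩
      obtain ⟨K, rfl⟩ := HomotopyCategory.quotient_obj_surjective K
      obtain ⟨⟨p, hp⟩, ⟨q, hq⟩, h⟩ := hK
      replace hp : CochainComplex.IsStrictlyGE K p := hp
      replace hq : CochainComplex.IsStrictlyLE K q := hq
      refine ⟨⟨p, inferInstanceAs (CochainComplex.IsStrictlyGE
        (((indFunctor k N G).mapHomologicalComplex _).obj K) p)⟩, ⟨q, inferInstanceAs
          (CochainComplex.IsStrictlyLE (((indFunctor k N G).mapHomologicalComplex _).obj K) q)⟩,
        fun i => ?_⟩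
      have : Module.Projective A₀ (FDMod.toModule (K.X i)) := h i
      exact inferInstanceAs (Module.Projective (OnePointExt A₀ N G)
        ((indFunctor k N G).obj (K.X i)).toModule))

instance : (indKb (A₀ := A₀) k N G).CommShift ℤ :=
  inferInstanceAs ((ObjectProperty.lift _ _ _).CommShift ℤ)

instance : (indKb (A₀ := A₀) k N G).IsTriangulated :=
  inferInstanceAs ((ObjectProperty.lift _ _ _).IsTriangulated)

variable {N G} in
lemma generates_of_summands (T₀ : KbProj k A₀) (hT₀ : IsTiltingComplex T₀)
    (T Y : KbProj k (OnePointExt A₀ N G))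
    (hY : Y.obj = (HomotopyCategory.singleFunctor _ 0).obj (objG k N G))
    (i₁ : (indKb k N G).obj T₀ ⟶ T) (p₁ : T ⟶ (indKb k N G).obj T₀) (h₁ : i₁ ≫ p₁ = 𝟙 _)
    (i₂ : Y ⟶ T) (p₂ : T ⟶ Y) (h₂ : i₂ ≫ p₂ = 𝟙 _)
    (P : ObjectProperty (KbProj k (OnePointExt A₀ N G))) (_ : P.IsTriangulated)
    (_ : P.IsClosedUnderIsomorphisms) (hP : addClosure T ≤ P) (X) : P X := by
  -- The preimage of `P` is a triangulated subcategory containing `add(T₀)`.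
  have hind : ∀ X, P ((indKb k N G).obj X) :=
    hT₀.generates (P.inverseImage (indKb k N G)) inferInstance inferInstance
      (fun X hX => hP _ (addClosure_map _ i₁ p₁ h₁ hX))
  have hPY : P Y := hP _ ((addClosure_iff _ _).2 ⟨1, fun _ => i₂, fun _ => p₂, by simp [h₂]⟩)
  -- The generation lemmas are stated in the whole homotopy category, so `P` is replaced by its
  -- image there.
  let P' := P.map (isBoundedProj k (OnePointExt A₀ N G)).ι
  have : P'.IsTriangulated := inferInstance
  suffices h : P' X.obj by
    obtain ⟨Z, hZ, ⟨e⟩⟩ := (P.prop_map_iff _ _).1 h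
    exact P.prop_of_iso ((isBoundedProj k (OnePointExt A₀ N G)).fullyFaithfulι.preimageIso e) hZ
  have hP' : ∀ M : FDMod k (OnePointExt A₀ N G), Projective M →
      P' ((HomotopyCategory.singleFunctor _ 0).obj M) := fun M hM => by
    refine prop_single_of_projective k P' (fun X hX => ?_) ?_ M ((FDMod.projective_iff M).1 hM)
    · have := hind ⟨_, isBoundedProj_single X⟩
      refine (P.prop_map_iff _ _).2 ⟨_, this, ⟨?_⟩⟩
      exact (HomotopyCategory.quotient _ _).mapIso
        ((HomologicalComplex.singleMapHomologicalComplex (indFunctor k N G) (.up ℤ) 0).app X)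
    · exact (P.prop_map_iff _ _).2 ⟨Y, hPY, ⟨eqToIso hY⟩⟩
  obtain ⟨K, ⟨p, hp⟩, ⟨q, hq⟩, h⟩ := X
  obtain ⟨K, rfl⟩ := HomotopyCategory.quotient_obj_surjective K
  replace hp : CochainComplex.IsStrictlyGE K p := hp
  replace hq : CochainComplex.IsStrictlyLE K q := hq
  -- The length of the interval `[p, q]`. If it is empty, `toNat` gives `0`, and `K` vanishes from
  -- `p` on.
  exact prop_of_bounded_projective P' hP' (q + 1 - p).toNat p K hp
    (fun i hi => CochainComplex.isZero_of_isStrictlyLE K q i (by lia))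
    (fun i => (FDMod.projective_iff _).2 (h i))

end Generation

/-! ### Additive bijections on morphisms, and transfer of vanishing into shifts. -/

section Generalities

variable {C D : Type*} [Category* C] [Category* D] [Preadditive C] [Preadditive D]

/-- The additive bijection on morphisms given by a fully faithful functor. -/
def mapAddEquiv (F : C ⥤ D) [F.Additive] [F.Full] [F.Faithful] (X Y : C) :
    (X ⟶ Y) ≃+ (F.obj X ⟶ F.obj Y) :=
  AddEquiv.ofBijective (F.mapAddHom (X := X) (Y := Y)) ⟨F.map_injective, F.map_surjective⟩

@[simp] lemma mapAddEquiv_apply (F : C ⥤ D) [F.Additive] [F.Full] [F.Faithful] {X Y : C}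
    (f : X ⟶ Y) : mapAddEquiv F X Y f = F.map f := rfl

/-- The additive bijection on morphisms given by isomorphisms of the source and the target. -/
def homCongrAddEquiv {X X' Y Y' : C} (e : X ≅ X') (e' : Y ≅ Y') : (X ⟶ Y) ≃+ (X' ⟶ Y') :=
  { Iso.homCongr e e' with map_add' := fun f g => by simp }

section Shift

variable [HasShift C ℤ] [∀ n : ℤ, (shiftFunctor C n).Additive]

/-- This lemma and the next use that shifting by `-i` and by `i` are mutually inverse, hence
faithful. -/
lemma hom_shift_eq_zero_of_shift_neg {X Y : C} (i : ℤ) (h : ∀ f : X⟦-i⟧ ⟶ Y, f = 0)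
    (f : X ⟶ Y⟦i⟧) : f = 0 := by
  apply (shiftFunctor C (-i)).map_injective
  rw [Functor.map_zero, ← cancel_mono (shiftShiftNeg Y i).hom, zero_comp]
  exact h _

lemma shift_neg_hom_eq_zero {X Y : C} (i : ℤ) (h : ∀ f : X ⟶ Y⟦i⟧, f = 0)
    (f : X⟦-i⟧ ⟶ Y) : f = 0 := by
  apply (shiftFunctor C i).map_injective
  rw [Functor.map_zero, ← cancel_epi (shiftNegShift X i).inv, comp_zero]
  exact h _

/-- Vanishing of morphisms to a shift is reflected by functors injective on these morphisms. -/
lemma hom_shift_eq_zero_of_map [HasShift D ℤ] (F : C ⥤ D) [F.Additive] [F.CommShift ℤ] {X Y : C}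
    (i : ℤ) (hF : Function.Injective (F.map : (X ⟶ Y⟦i⟧) → _))
    (h : ∀ f : F.obj X ⟶ (F.obj Y)⟦i⟧, f = 0) (f : X ⟶ Y⟦i⟧) : f = 0 := by
  apply hF
  rw [F.map_zero, ← cancel_mono ((F.commShiftIso i).hom.app Y), zero_comp]
  exact h _

/-- Vanishing of morphisms to a shift is preserved by functors surjective on these morphisms. -/
lemma map_hom_shift_eq_zero [HasShift D ℤ] (F : C ⥤ D) [F.Additive] [F.CommShift ℤ] {X Y : C}
    (i : ℤ) (hF : Function.Surjective (F.map : (X ⟶ Y⟦i⟧) → _))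
    (h : ∀ f : X ⟶ Y⟦i⟧, f = 0) (f : F.obj X ⟶ (F.obj Y)⟦i⟧) : f = 0 := by
  rw [← cancel_mono ((F.commShiftIso i).inv.app Y), zero_comp]
  obtain ⟨g, hg⟩ := hF (f ≫ (F.commShiftIso i).inv.app Y)
  rw [← hg, h g, F.map_zero]

lemma hom_shift_eq_zero_of_iso {X X' Y Y' : C} (e : X ≅ X') (e' : Y ≅ Y') (i : ℤ)
    (h : ∀ f : X ⟶ Y⟦i⟧, f = 0) (f : X' ⟶ Y'⟦i⟧) : f = 0 := by
  rw [← cancel_mono ((shiftFunctor C i).map e'.inv), ← cancel_epi e.hom, zero_comp, comp_zero]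
  exact h _

end Shift

end Generalities

/-! ### Comparison of the homotopy category with the bounded derived category. -/

section Db

variable {k : Type w} [Field k] {A : Type u} [Ring A] [Algebra k A] [FiniteDimensional k A]
  [HasDerivedCategory.{v} (FDMod k A)]

instance : (stalk k A).Full where
  map_surjective f := by
    obtain ⟨g, hg⟩ := (DerivedCategory.singleFunctor (FDMod k A) 0).map_surjective f.hom
    exact ⟨g, ObjectProperty.hom_ext _ hg⟩
instance : (stalk k A).Faithful where
  map_injective h := (DerivedCategory.singleFunctor (FDMod k A) 0).map_injective
    (congrArg (fun l => l.hom) h)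
instance : (stalk k A).Additive where
  map_add {_ _ f g} := ObjectProperty.hom_ext _
    ((DerivedCategory.singleFunctor (FDMod k A) 0).map_add (f := f) (g := g))
instance : (stalk k A).Linear k where
  map_smul f c := ObjectProperty.hom_ext _
    ((DerivedCategory.singleFunctor (FDMod k A) 0).map_smul c f)

lemma isKProjective_of_isBoundedProj {K : CochainComplex (FDMod k A) ℤ}
    (hK : isBoundedProj k A ((HomotopyCategory.quotient _ _).obj K)) : K.IsKProjective := by
  obtain ⟨-, ⟨q, hq⟩, h⟩ := hK
  have : K.IsStrictlyLE q := hq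
  have : ∀ i, Projective (K.X i) := fun i => (FDMod.projective_iff _).2 (h i)
  exact CochainComplex.isKProjective_of_projective K q

/-- `T` is bounded above with projective terms, hence K-projective; `L` is arbitrary, so the stalk
of a nonprojective module is allowed as target. -/
lemma Qh_map_bijective (T : KbProj k A) (L : HomotopyCategory (FDMod k A) (.up ℤ)) :
    Function.Bijective (DerivedCategory.Qh.map : (T.obj ⟶ L) → _) := by
  obtain ⟨K, hK⟩ := T
  obtain ⟨K, rfl⟩ := HomotopyCategory.quotient_obj_surjective K
  have := isKProjective_of_isBoundedProj hK
  exact CochainComplex.IsKProjective.Qh_map_bijective K L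

instance : (KbProj.toDb k A).Full where
  map_surjective {X Y} f := by
    obtain ⟨g, hg⟩ := (Qh_map_bijective X Y.obj).2 f.hom
    exact ⟨ObjectProperty.homMk g, ObjectProperty.hom_ext _ hg⟩
instance : (KbProj.toDb k A).Faithful where
  map_injective {X Y _ _} h :=
    ObjectProperty.hom_ext _ ((Qh_map_bijective X Y.obj).1 (congrArg (fun l => l.hom) h))
instance : (KbProj.toDb k A).Additive where
  map_add := ObjectProperty.hom_ext _ (DerivedCategory.Qh.map_add)
instance : (KbProj.toDb k A).Linear k where
  map_smul f c := ObjectProperty.hom_ext _ (DerivedCategory.Qh.map_smul c f.hom)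

/-- Morphisms from a bounded complex of projectives to a stalk complex can be computed in the
homotopy category. -/
def stalkHomEquiv (T : KbProj k A) (M : FDMod k A) :
    (T.obj ⟶ (HomotopyCategory.singleFunctor _ 0).obj M) ≃+
      ((KbProj.toDb k A).obj T ⟶ (stalk k A).obj M) :=
  AddEquiv.ofBijective
    (AddMonoidHom.mk' (fun f => (ObjectProperty.homMk (DerivedCategory.Qh.map f) :
        (KbProj.toDb k A).obj T ⟶ (stalk k A).obj M))
      (fun _ _ => ObjectProperty.hom_ext _ DerivedCategory.Qh.map_add))
    ⟨fun _ _ h => (Qh_map_bijective T _).1 (congrArg (fun l => l.hom) h), fun f => by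
      obtain ⟨g, hg⟩ := (Qh_map_bijective T _).2 f.hom
      exact ⟨g, ObjectProperty.hom_ext _ hg⟩⟩

lemma stalkHomEquiv_comp (T : KbProj k A) {M M' : FDMod k A}
    (f : T.obj ⟶ (HomotopyCategory.singleFunctor _ 0).obj M) (g : M ⟶ M') :
    stalkHomEquiv T M' (f ≫ (HomotopyCategory.singleFunctor _ 0).map g) =
      stalkHomEquiv T M f ≫ (stalk k A).map g :=
  ObjectProperty.hom_ext _ (DerivedCategory.Qh.map_comp _ _)

lemma comp_stalkHomEquiv {T T' : KbProj k A} {M : FDMod k A} (g : T' ⟶ T)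
    (f : T.obj ⟶ (HomotopyCategory.singleFunctor _ 0).obj M) :
    stalkHomEquiv T' M (g.hom ≫ f) = (KbProj.toDb k A).map g ≫ stalkHomEquiv T M f :=
  ObjectProperty.hom_ext _ (DerivedCategory.Qh.map_comp _ _)

variable (k) in
/-- Elements of `M` as morphisms from the regular module. -/
def evalEquiv (M : Type u) [AddCommGroup M] [Module k M] [Module A M] [IsScalarTower k A M]
    [FiniteDimensional k M] : M ≃+ (FDMod.of k A A ⟶ FDMod.of k A M) where
  toFun m := FDMod.ofHom (LinearMap.toSpanSingleton A M m)
  invFun f := FDMod.toLin f (1 : A)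
  left_inv m := one_smul A m
  right_inv f := FDMod.hom_ext fun x : A =>
    ((FDMod.toLin f).map_smul x (1 : A)).symm.trans (congrArg (FDMod.toLin f) (mul_one x))
  map_add' m m' := FDMod.hom_ext fun x : A => smul_add x m m'

/-- Elements of `A` act on the regular module by right multiplication, so products become composites
in diagrammatic order. -/
lemma evalEquiv_smul (M : Type u) [AddCommGroup M] [Module k M] [Module A M] [IsScalarTower k A M]
    [FiniteDimensional k M] (a : A) (m : M) :
    evalEquiv k M (a • m) = evalEquiv k A a ≫ evalEquiv k M m :=
  FDMod.hom_ext fun x : A => (mul_smul x a m).symm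

lemma evalEquiv_algebraMap (c : k) :
    evalEquiv k A (algebraMap k A c) = c • 𝟙 (FDMod.of k A A) :=
  FDMod.hom_ext fun x : A => (Algebra.commutes c x).symm

lemma evalEquiv_comp {M M' : Type u} [AddCommGroup M] [Module k M] [Module A M]
    [IsScalarTower k A M] [FiniteDimensional k M] [AddCommGroup M'] [Module k M'] [Module A M']
    [IsScalarTower k A M'] [FiniteDimensional k M'] (f : M →ₗ[A] M') (m : M) :
    evalEquiv k M' (f m) = evalEquiv k M m ≫ FDMod.ofHom f :=
  FDMod.hom_ext fun x : A => (f.map_smul x m).symm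

lemma stalk_hom_shift_eq_zero (T : KbProj k A) (M : FDMod k A) (i : ℤ)
    (h : ∀ f : (KbProj.toDb k A).obj T ⟶ ((stalk k A).obj M)⟦i⟧, f = 0)
    (f : T.obj ⟶ ((HomotopyCategory.singleFunctor _ 0).obj M)⟦i⟧) : f = 0 :=
  hom_shift_eq_zero_of_map DerivedCategory.Qh i (Qh_map_bijective T _).1
    (map_hom_shift_eq_zero DerivedCategory.Bounded.ι (X := (KbProj.toDb k A).obj T)
      (Y := (stalk k A).obj M) i (Functor.map_surjective _) h) f

/-- Projectivity of `Q` lets the morphisms be computed up to homotopy, where stalks in different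
degrees have none; positive and negative `i` are treated alike. -/
lemma stalk_hom_stalk_shift_eq_zero (Q M : FDMod k A) [Module.Projective A Q.toModule] (i : ℤ)
    (hi : i ≠ 0) (f : (stalk k A).obj Q ⟶ ((stalk k A).obj M)⟦i⟧) : f = 0 :=
  hom_shift_eq_zero_of_map DerivedCategory.Bounded.ι (X := (stalk k A).obj Q)
    (Y := (stalk k A).obj M) i (Functor.map_injective _)
    (map_hom_shift_eq_zero DerivedCategory.Qh i
      (X := (HomotopyCategory.singleFunctor _ 0).obj Q)
      (Y := (HomotopyCategory.singleFunctor _ 0).obj M)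
      (Qh_map_bijective ⟨_, isBoundedProj_single Q⟩ _).2
      (fun g => single_hom_single_shift_eq_zero i hi g)) f

end Db

/-! ### Transport of the right `G`-action from `N` to `N'`. -/

section Bimodule

variable {k : Type w} [Field k]
    {A₀ : Type u} [Ring A₀] [Algebra k A₀] [FiniteDimensional k A₀]
    {B₀ : Type u} [Ring B₀] [Algebra k B₀] [FiniteDimensional k B₀]
    [HasDerivedCategory.{v₁} (FDMod k A₀)] [HasDerivedCategory.{v₂} (FDMod k B₀)]
    (Φ₀ : DerivedCategory.Bounded (FDMod k A₀) ⥤ DerivedCategory.Bounded (FDMod k B₀))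
    {G : Type u} [Ring G] [Algebra k G]
    {N : Type u} [AddCommGroup N] [Module k N] [FiniteDimensional k N]
    [Module A₀ N] [Module Gᵐᵒᵖ N] [SMulCommClass A₀ Gᵐᵒᵖ N]
    [IsScalarTower k A₀ N] [IsScalarTower k Gᵐᵒᵖ N]
    {N' : Type u} [AddCommGroup N'] [Module k N'] [FiniteDimensional k N']
    [Module B₀ N'] [IsScalarTower k B₀ N']

/-- Conjugating `Φ₀(ρ_g)` by `φ` gives endomorphisms of the stalk of `N'`. They come from unique
endomorphisms of `N'`, and uniqueness yields the module axioms. Linearity of `Φ₀` makes `k` act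
centrally. -/
lemma exists_transported_bimodule [Φ₀.Additive] [Φ₀.Linear k]
    (φ : Φ₀.obj ((stalk k A₀).obj (FDMod.of k A₀ N)) ≅ (stalk k B₀).obj (FDMod.of k B₀ N')) :
    ∃ (_ : Module Gᵐᵒᵖ N') (_ : SMulCommClass B₀ Gᵐᵒᵖ N') (_ : IsScalarTower k Gᵐᵒᵖ N'),
      ∀ g : G, Φ₀.map ((stalk k A₀).map (FDMod.ofHom (rightMul g : N →ₗ[A₀] N))) ≫ φ.hom =
        φ.hom ≫ (stalk k B₀).map (FDMod.ofHom (rightMul g : N' →ₗ[B₀] N')) := by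
  let ρ : G → (FDMod.of k A₀ N ⟶ FDMod.of k A₀ N) := fun g => FDMod.ofHom (rightMul g)
  let ψ : G → (FDMod.of k B₀ N' ⟶ FDMod.of k B₀ N') := fun g =>
    (stalk k B₀).preimage (φ.inv ≫ Φ₀.map ((stalk k A₀).map (ρ g)) ≫ φ.hom)
  have hψ : ∀ g, (stalk k B₀).map (ψ g) = φ.inv ≫ Φ₀.map ((stalk k A₀).map (ρ g)) ≫ φ.hom :=
    fun g => (stalk k B₀).map_preimage _
  have inj : ∀ {f g : FDMod.of k B₀ N' ⟶ FDMod.of k B₀ N'},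
      (stalk k B₀).map f = (stalk k B₀).map g → f = g :=
    fun h => (stalk k B₀).map_injective h
  have ψ_one : ψ 1 = 𝟙 _ := inj (by
    have : ρ 1 = 𝟙 _ := FDMod.hom_ext fun x : N => one_smul Gᵐᵒᵖ x
    rw [hψ, this]; simp)
  -- First `g`, then `h`: the rule of a right action.
  have ψ_mul : ∀ g h, ψ (g * h) = ψ g ≫ ψ h := fun g h => inj (by
    have : ρ (g * h) = ρ g ≫ ρ h := FDMod.hom_ext fun x : N => mul_smul (op h) (op g) x
    rw [(stalk k B₀).map_comp, hψ, hψ, hψ, this]; simp)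
  have ψ_add : ∀ g h, ψ (g + h) = ψ g + ψ h := fun g h => inj (by
    have : ρ (g + h) = ρ g + ρ h := FDMod.hom_ext fun x : N => add_smul (op g) (op h) x
    rw [(stalk k B₀).map_add, hψ, hψ, hψ, this]; simp)
  have ψ_smul : ∀ (c : k) g, ψ (c • g) = c • ψ g := fun c g => inj (by
    have : ρ (c • g) = c • ρ g := FDMod.hom_ext fun x : N =>
      (smul_assoc c (op g) x).trans (algebraMap_smul A₀ c _).symm
    rw [(stalk k B₀).map_smul, hψ, hψ, this]; simp)
  have ψ_zero : ψ 0 = 0 := by simpa using ψ_smul 0 0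
  let ψ' : G → (N' →ₗ[B₀] N') := fun g => FDMod.toLin (ψ g)
  let m : Module Gᵐᵒᵖ N' :=
    { smul := fun g x => ψ' g.unop x
      one_smul := fun x => congrArg (fun l => FDMod.toLin l x) ψ_one
      mul_smul := fun g h x => congrArg (fun l => FDMod.toLin l x) (ψ_mul h.unop g.unop)
      smul_zero := fun g => (ψ' g.unop).map_zero
      smul_add := fun g => (ψ' g.unop).map_add
      add_smul := fun g h x => congrArg (fun l => FDMod.toLin l x) (ψ_add g.unop h.unop)
      zero_smul := fun x => congrArg (fun l => FDMod.toLin l x) ψ_zero }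
  have sc : SMulCommClass B₀ Gᵐᵒᵖ N' := ⟨fun b g x => ((ψ' g.unop).map_smul b x).symm⟩
  refine ⟨m, sc,
    ⟨fun c g x => (congrArg (fun l => FDMod.toLin l x) (ψ_smul c g.unop)).trans
      (algebraMap_smul B₀ c (ψ' g.unop x))⟩, fun g => ?_⟩
  have : (FDMod.ofHom (rightMul g : N' →ₗ[B₀] N')) = ψ g := FDMod.hom_ext fun _ => rfl
  rw [this, hψ, Iso.hom_inv_id_assoc]

end Bimodule

/-! ### The two summands of `T` and the morphisms between them in the homotopy category. -/

section Ext

open OnePointExt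

variable (k : Type w) [Field k] {A₀ : Type u} [Ring A₀] [Algebra k A₀] [FiniteDimensional k A₀]
  (N G : Type u) [DivisionRing G] [Algebra k G] [FiniteDimensional k G]
  [AddCommGroup N] [Module k N] [FiniteDimensional k N] [Module A₀ N] [Module Gᵐᵒᵖ N]
  [SMulCommClass A₀ Gᵐᵒᵖ N] [IsScalarTower k A₀ N] [IsScalarTower k Gᵐᵒᵖ N]

instance : (indKb (A₀ := A₀) k N G).Full where
  map_surjective f := by
    obtain ⟨g, hg⟩ := ((indFunctor k N G).mapHomotopyCategory (.up ℤ)).map_surjective f.hom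
    exact ⟨ObjectProperty.homMk g, ObjectProperty.hom_ext _ hg⟩

instance : (indKb (A₀ := A₀) k N G).Faithful where
  map_injective h := ObjectProperty.hom_ext _
    (((indFunctor k N G).mapHomotopyCategory (.up ℤ)).map_injective (congrArg (fun l => l.hom) h))

instance : (indKb (A₀ := A₀) k N G).Linear k where
  map_smul f c := ObjectProperty.hom_ext _
    (((indFunctor k N G).mapHomotopyCategory (.up ℤ)).map_smul c f.hom)

/-- The complex `A e_G[0]`. -/
def kbG : KbProj k (OnePointExt A₀ N G) :=
  ⟨(HomotopyCategory.singleFunctor _ 0).obj (objG k N G), isBoundedProj_single _⟩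

/-- The endomorphisms of `A e_G[0]`. -/
def kbGEquiv : G ≃+ (kbG (A₀ := A₀) k N G ⟶ kbG k N G) :=
  ((mulGEquiv k).trans (mapAddEquiv (HomotopyCategory.singleFunctor _ 0) _ _)).trans
    (mapAddEquiv (isBoundedProj k (OnePointExt A₀ N G)).ι (kbG k N G) (kbG k N G)).symm

variable {N G}

lemma kbGEquiv_hom (g : G) : (kbGEquiv (A₀ := A₀) k N G g).hom =
    (HomotopyCategory.singleFunctor _ 0).map (mulG k N G g) :=
  (mapAddEquiv (isBoundedProj k (OnePointExt A₀ N G)).ι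
    (kbG k N G) (kbG k N G)).apply_symm_apply _

variable (N G) in
/-- The inclusion of `A e₀ ⊗_{A₀} N[0]` into `A e_G[0]`. -/
def inclNh : ((indFunctor k N G).mapHomotopyCategory (.up ℤ)).obj
      ((HomotopyCategory.singleFunctor _ 0).obj (FDMod.of k A₀ N)) ⟶
    (HomotopyCategory.singleFunctor _ 0).obj (objG k N G) :=
  (HomotopyCategory.quotient _ _).map (singleCoreflection (inclN k N G) 0)

lemma inclNh_comp (g : G) :
    inclNh k N G ≫ (HomotopyCategory.singleFunctor _ 0).map (mulG k N G g) =
      ((indFunctor k N G).mapHomotopyCategory (.up ℤ)).map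
        ((HomotopyCategory.singleFunctor _ 0).map
          (FDMod.ofHom (rightMul g : N →ₗ[A₀] N))) ≫ inclNh k N G := by
  have h : singleCoreflection (c := .up ℤ) (inclN (A₀ := A₀) k N G) 0 ≫
        (HomologicalComplex.single _ (.up ℤ) 0).map (mulG k N G g) =
      ((indFunctor k N G).mapHomologicalComplex (.up ℤ)).map
        ((HomologicalComplex.single _ (.up ℤ) 0).map (FDMod.ofHom (rightMul g : N →ₗ[A₀] N))) ≫
          singleCoreflection (inclN k N G) 0 := by
    rw [singleCoreflection, Category.assoc, ← Functor.map_comp, inclN_comp_mulG, Functor.map_comp]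
    exact ((HomologicalComplex.singleMapHomologicalComplex (indFunctor k N G) (.up ℤ)
      (0 : ℤ)).hom.naturality_assoc (FDMod.ofHom (rightMul g : N →ₗ[A₀] N)) _).symm
  exact ((HomotopyCategory.quotient _ _).map_comp _ _).symm.trans
    ((congrArg (HomotopyCategory.quotient _ _).map h).trans
      ((HomotopyCategory.quotient _ _).map_comp _ _))

lemma inclNh_bijective (K : HomotopyCategory (FDMod k A₀) (.up ℤ)) :
    Function.Bijective (fun f : K ⟶ (HomotopyCategory.singleFunctor _ 0).obj (FDMod.of k A₀ N) =>
      ((indFunctor k N G).mapHomotopyCategory (.up ℤ)).map f ≫ inclNh k N G) := by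
  obtain ⟨K, rfl⟩ := HomotopyCategory.quotient_obj_surjective K
  exact bijective_mapHomotopyCategory_of_isCoreflection _
    (isCoreflection_single (isCoreflection_inclN k) 0)

variable (N G) in
/-- Morphisms from `A e₀ ⊗_{A₀} T` to `A e_G[0]` are morphisms from `T` to `N[0]`. -/
def indHomEquiv (T : KbProj k A₀) :
    (T.obj ⟶ (HomotopyCategory.singleFunctor _ 0).obj (FDMod.of k A₀ N)) ≃+
      ((indKb k N G).obj T ⟶ kbG k N G) :=
  AddEquiv.ofBijective
    (AddMonoidHom.mk' (fun f => (ObjectProperty.homMk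
        (((indFunctor k N G).mapHomotopyCategory (.up ℤ)).map f ≫ inclNh k N G) :
          (indKb k N G).obj T ⟶ kbG k N G))
      (fun f g => ObjectProperty.hom_ext _ (by
        change ((indFunctor k N G).mapHomotopyCategory (.up ℤ)).map (f + g) ≫ inclNh k N G =
          ((indFunctor k N G).mapHomotopyCategory (.up ℤ)).map f ≫ inclNh k N G +
          ((indFunctor k N G).mapHomotopyCategory (.up ℤ)).map g ≫ inclNh k N G
        rw [Functor.map_add, Preadditive.add_comp])))
    ⟨fun _ _ h => (inclNh_bijective k _).1 (congrArg (fun l => l.hom) h), fun f => by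
      obtain ⟨g, hg⟩ := (inclNh_bijective k T.obj).2 f.hom
      exact ⟨g, ObjectProperty.hom_ext _ hg⟩⟩

lemma indHomEquiv_hom (T : KbProj k A₀)
    (f : T.obj ⟶ (HomotopyCategory.singleFunctor _ 0).obj (FDMod.of k A₀ N)) :
    (indHomEquiv k N G T f).hom =
      ((indFunctor k N G).mapHomotopyCategory (.up ℤ)).map f ≫ inclNh k N G := rfl

lemma indHomEquiv_comp (T : KbProj k A₀)
    (f : T.obj ⟶ (HomotopyCategory.singleFunctor _ 0).obj (FDMod.of k A₀ N)) (g : G) :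
    indHomEquiv k N G T (f ≫ (HomotopyCategory.singleFunctor _ 0).map
      (FDMod.ofHom (rightMul g : N →ₗ[A₀] N))) = indHomEquiv k N G T f ≫ kbGEquiv k N G g := by
  apply ObjectProperty.hom_ext
  rw [ObjectProperty.FullSubcategory.comp_hom, indHomEquiv_hom, indHomEquiv_hom, kbGEquiv_hom,
    Functor.map_comp, Category.assoc, ← inclNh_comp]
  exact (Category.assoc _ _ _).symm

lemma comp_indHomEquiv {T T' : KbProj k A₀} (g : T' ⟶ T)
    (f : T.obj ⟶ (HomotopyCategory.singleFunctor _ 0).obj (FDMod.of k A₀ N)) :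
    indHomEquiv k N G T' (g.hom ≫ f) = (indKb k N G).map g ≫ indHomEquiv k N G T f := by
  apply ObjectProperty.hom_ext
  rw [ObjectProperty.FullSubcategory.comp_hom, indHomEquiv_hom, indHomEquiv_hom, Functor.map_comp]
  exact Category.assoc _ _ _

/-- A morphism from a stalk is determined by one component `A e_G → A e₀ ⊗ T^i`, and that is zero.
-/
lemma kbG_hom_ind_shift_eq_zero (T : KbProj k A₀) (i : ℤ)
    (f : kbG k N G ⟶ ((indKb k N G).obj T)⟦i⟧) : f = 0 :=
  hom_shift_eq_zero_of_map (isBoundedProj k (OnePointExt A₀ N G)).ι (X := kbG k N G)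
    (Y := (indKb k N G).obj T) i (Functor.map_injective _)
    (fun f => single_hom_shift_eq_zero
      (L := ((indFunctor k N G).mapHomologicalComplex (.up ℤ)).obj T.obj.as) i
      (fun g => objG_hom_ind_eq_zero k g) f) f

lemma kbG_hom_ind_eq_zero (T : KbProj k A₀) (f : kbG k N G ⟶ (indKb k N G).obj T) : f = 0 :=
  ObjectProperty.hom_ext _ (single_hom_eq_zero
      (L := ((indFunctor k N G).mapHomologicalComplex (.up ℤ)).obj T.obj.as)
      (fun g => objG_hom_ind_eq_zero k g) f.hom)

lemma kbG_hom_shift_eq_zero (i : ℤ) (hi : i ≠ 0)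
    (f : kbG (A₀ := A₀) k N G ⟶ (kbG k N G)⟦i⟧) : f = 0 :=
  hom_shift_eq_zero_of_map (isBoundedProj k (OnePointExt A₀ N G)).ι (X := kbG k N G)
    (Y := kbG k N G) i (Functor.map_injective _)
    (fun f => single_hom_single_shift_eq_zero i hi f) f

/-- `inclNh_bijective` allows an arbitrary source but only the unshifted target, so the shift is
moved to the source and back. -/
lemma ind_hom_shift_eq_zero (T : KbProj k A₀) (i : ℤ)
    (h : ∀ f : T.obj ⟶ ((HomotopyCategory.singleFunctor _ 0).obj (FDMod.of k A₀ N))⟦i⟧, f = 0)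
    (f : (indKb k N G).obj T ⟶ (kbG k N G)⟦i⟧) : f = 0 := by
  refine hom_shift_eq_zero_of_map (isBoundedProj k (OnePointExt A₀ N G)).ι i
    (Functor.map_injective _) (hom_shift_eq_zero_of_shift_neg i fun f => ?_) f
  let Ψ := (indFunctor (A₀ := A₀) k N G).mapHomotopyCategory (.up ℤ)
  let c : Ψ.obj (T.obj⟦-i⟧) ≅ (Ψ.obj T.obj)⟦-i⟧ := (Ψ.commShiftIso (-i)).app T.obj
  let f' : (Ψ.obj T.obj)⟦-i⟧ ⟶ (HomotopyCategory.singleFunctor _ 0).obj (objG k N G) := f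
  suffices f' = 0 from this
  obtain ⟨g, hg⟩ := (inclNh_bijective (G := G) k (T.obj⟦-i⟧)).2 (c.hom ≫ f')
  rw [shift_neg_hom_eq_zero i h g] at hg
  rw [← cancel_epi c.hom, ← hg, comp_zero]
  exact (congrArg (· ≫ inclNh k N G) (Ψ.map_zero _ _)).trans zero_comp

lemma isBoundedProj_extComplex (T₀ : KbProj k A₀) :
    isBoundedProj k (OnePointExt A₀ N G)
      ((HomotopyCategory.quotient _ _).obj (extComplex k N G T₀.obj.as)) :=
  isBoundedProj_biprod _ _ ((indKb k N G).obj T₀).property (kbG k N G).property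

variable (N G) in
/-- The complex `(A e₀ ⊗_{A₀} T₀) ⊕ A e_G[0]`. -/
abbrev kbExt (T₀ : KbProj k A₀) : KbProj k (OnePointExt A₀ N G) :=
  ⟨_, isBoundedProj_extComplex k T₀⟩

variable (N G) in
/-- `kbExt` as a direct sum. -/
lemma exists_kbExt_decomposition (T₀ : KbProj k A₀) :
    ∃ (i₁ : (indKb k N G).obj T₀ ⟶ kbExt k N G T₀) (p₁ : kbExt k N G T₀ ⟶ (indKb k N G).obj T₀)
      (i₂ : kbG k N G ⟶ kbExt k N G T₀) (p₂ : kbExt k N G T₀ ⟶ kbG k N G),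
      i₁ ≫ p₁ = 𝟙 _ ∧ i₂ ≫ p₂ = 𝟙 _ ∧ i₁ ≫ p₂ = 0 ∧ p₁ ≫ i₁ + p₂ ≫ i₂ = 𝟙 _ := by
  let q := HomotopyCategory.quotient (FDMod k (OnePointExt A₀ N G)) (.up ℤ)
  let K := ((indFunctor k N G).mapHomologicalComplex (.up ℤ)).obj T₀.obj.as
  let L := (HomologicalComplex.single _ (.up ℤ) (0 : ℤ)).obj (objG (A₀ := A₀) k N G)
  have hc : ∀ {X Y Z : CochainComplex (FDMod k (OnePointExt A₀ N G)) ℤ} (f : X ⟶ Y) (g : Y ⟶ Z),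
    q.map f ≫ q.map g = q.map (f ≫ g) := fun f g => (q.map_comp f g).symm
  refine ⟨ObjectProperty.homMk (q.map (biprod.inl : K ⟶ K ⊞ L)),
    ObjectProperty.homMk (q.map (biprod.fst : K ⊞ L ⟶ K)),
    ObjectProperty.homMk (q.map (biprod.inr : L ⟶ K ⊞ L)),
    ObjectProperty.homMk (q.map (biprod.snd : K ⊞ L ⟶ L)), ?_, ?_, ?_, ?_⟩
  · exact ObjectProperty.hom_ext _ ((hc _ _).trans
      ((congrArg q.map biprod.inl_fst).trans (q.map_id _)))
  · exact ObjectProperty.hom_ext _ ((hc _ _).trans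
      ((congrArg q.map biprod.inr_snd).trans (q.map_id _)))
  · exact ObjectProperty.hom_ext _ ((hc _ _).trans
      ((congrArg q.map biprod.inl_snd).trans (q.map_zero _ _)))
  · refine ObjectProperty.hom_ext _ ((congrArg₂ (· + ·) (hc _ _) (hc _ _)).trans ?_)
    exact q.map_add.symm.trans ((congrArg q.map biprod.total).trans (q.map_id _))

end Ext

/-! ### The tilting property and the endomorphism algebra. -/

section Main

open OnePointExt

variable {k : Type w} [Field k]
    {A₀ : Type u} [Ring A₀] [Algebra k A₀] [FiniteDimensional k A₀]
    {B₀ : Type u} [Ring B₀] [Algebra k B₀] [FiniteDimensional k B₀]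
    [HasDerivedCategory.{v₁} (FDMod k A₀)] [HasDerivedCategory.{v₂} (FDMod k B₀)]
    (Φ₀ : DerivedCategory.Bounded (FDMod k A₀) ⥤ DerivedCategory.Bounded (FDMod k B₀))
    [Φ₀.IsEquivalence] [Φ₀.CommShift ℤ] [Φ₀.IsTriangulated] [Φ₀.Linear k]
    (T₀ : KbProj k A₀)
    {G : Type u} [DivisionRing G] [Algebra k G] [FiniteDimensional k G]
    {N : Type u} [AddCommGroup N] [Module k N] [FiniteDimensional k N]
    [Module A₀ N] [Module Gᵐᵒᵖ N] [SMulCommClass A₀ Gᵐᵒᵖ N]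
    [IsScalarTower k A₀ N] [IsScalarTower k Gᵐᵒᵖ N]
    {N' : Type u} [AddCommGroup N'] [Module k N'] [FiniteDimensional k N']
    [Module B₀ N'] [IsScalarTower k B₀ N']

/-- Here it matters that `Φ₀` sends `N` to a stalk: the morphisms become those from `B₀` to `N'[i]`
in the derived category. -/
lemma hom_stalk_shift_eq_zero
    (e : Φ₀.obj ((KbProj.toDb k A₀).obj T₀) ≅ (stalk k B₀).obj (FDMod.of k B₀ B₀))
    (φ : Φ₀.obj ((stalk k A₀).obj (FDMod.of k A₀ N)) ≅ (stalk k B₀).obj (FDMod.of k B₀ N')) (i : ℤ) (hi : i ≠ 0)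
    (f : T₀.obj ⟶ ((HomotopyCategory.singleFunctor _ 0).obj (FDMod.of k A₀ N))⟦i⟧) : f = 0 := by
  have : Module.Projective B₀ (FDMod.of k B₀ B₀).toModule :=
    inferInstanceAs (Module.Projective B₀ B₀)
  exact stalk_hom_shift_eq_zero T₀ _ i (hom_shift_eq_zero_of_map Φ₀ i Φ₀.map_injective
    (hom_shift_eq_zero_of_iso e.symm φ.symm i (stalk_hom_stalk_shift_eq_zero _ _ i hi))) f

/-- The four blocks of a morphism `T ⟶ T⟦i⟧` vanish separately; only the one from `A e₀ ⊗ T₀` to `A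
e_G` involves `Φ₀`. -/
lemma isTiltingComplex_kbExt
    (e : Φ₀.obj ((KbProj.toDb k A₀).obj T₀) ≅ (stalk k B₀).obj (FDMod.of k B₀ B₀))
    (φ : Φ₀.obj ((stalk k A₀).obj (FDMod.of k A₀ N)) ≅ (stalk k B₀).obj (FDMod.of k B₀ N'))
    (hT₀ : IsTiltingComplex T₀) :
    IsTiltingComplex (kbExt k N G T₀) := by
  obtain ⟨i₁, p₁, i₂, p₂, h₁, h₂, h₁₂, hid⟩ := exists_kbExt_decomposition k N G T₀
  refine ⟨fun i hi f => ?_, generates_of_summands k T₀ hT₀ _ (kbG k N G) rfl i₁ p₁ h₁ i₂ p₂ h₂⟩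
  have e₁ : i₁ ≫ f ≫ p₁⟦i⟧' = 0 :=
    map_hom_shift_eq_zero (indKb k N G) i (Functor.map_surjective _)
      (hT₀.hom_shift_eq_zero i hi) _
  have e₂ : i₁ ≫ f ≫ p₂⟦i⟧' = 0 :=
    ind_hom_shift_eq_zero k T₀ i (hom_stalk_shift_eq_zero Φ₀ T₀ e φ i hi) _
  have e₃ : i₂ ≫ f ≫ p₁⟦i⟧' = 0 := kbG_hom_ind_shift_eq_zero k T₀ i _
  have e₄ : i₂ ≫ f ≫ p₂⟦i⟧' = 0 := kbG_hom_shift_eq_zero k i hi _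
  have hid' : (p₁⟦i⟧' ≫ i₁⟦i⟧' + p₂⟦i⟧' ≫ i₂⟦i⟧') = 𝟙 ((kbExt k N G T₀)⟦i⟧) := by
    rw [← Functor.map_comp, ← Functor.map_comp, ← Functor.map_add, hid]
    exact CategoryTheory.Functor.map_id _ _
  calc f = (p₁ ≫ i₁ + p₂ ≫ i₂) ≫ f ≫ (p₁⟦i⟧' ≫ i₁⟦i⟧' + p₂⟦i⟧' ≫ i₂⟦i⟧') := by
        rw [hid, hid']; simp
    _ = p₁ ≫ (i₁ ≫ f ≫ p₁⟦i⟧') ≫ i₁⟦i⟧' + p₁ ≫ (i₁ ≫ f ≫ p₂⟦i⟧') ≫ i₂⟦i⟧' +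
        (p₂ ≫ (i₂ ≫ f ≫ p₁⟦i⟧') ≫ i₁⟦i⟧' + p₂ ≫ (i₂ ≫ f ≫ p₂⟦i⟧') ≫ i₂⟦i⟧') := by
        simp only [Preadditive.add_comp, Preadditive.comp_add, Category.assoc]
        abel
    _ = 0 := by rw [e₁, e₂, e₃, e₄]; simp

section

variable (e : Φ₀.obj ((KbProj.toDb k A₀).obj T₀) ≅ (stalk k B₀).obj (FDMod.of k B₀ B₀))
  (φ : Φ₀.obj ((stalk k A₀).obj (FDMod.of k A₀ N)) ≅ (stalk k B₀).obj (FDMod.of k B₀ N'))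

/-- The endomorphisms of `T₀`. -/
def endEquiv : B₀ ≃+ (T₀ ⟶ T₀) :=
  (((evalEquiv k B₀).trans (mapAddEquiv (stalk k B₀) _ _)).trans
    (homCongrAddEquiv e.symm e.symm)).trans
    ((mapAddEquiv (KbProj.toDb k A₀) T₀ T₀).trans (mapAddEquiv Φ₀ _ _)).symm

lemma map_endEquiv (b : B₀) : Φ₀.map ((KbProj.toDb k A₀).map (endEquiv Φ₀ T₀ e b)) =
    e.hom ≫ (stalk k B₀).map (evalEquiv k B₀ b) ≫ e.inv :=
  ((mapAddEquiv (KbProj.toDb k A₀) T₀ T₀).trans (mapAddEquiv Φ₀ _ _)).apply_symm_apply _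

/-- The morphisms from `T₀` to `N[0]`. -/
def homNEquiv : N' ≃+ (T₀.obj ⟶ (HomotopyCategory.singleFunctor _ 0).obj (FDMod.of k A₀ N)) :=
  (((evalEquiv k N').trans (mapAddEquiv (stalk k B₀) _ _)).trans
    (homCongrAddEquiv e.symm φ.symm)).trans
    ((stalkHomEquiv T₀ (FDMod.of k A₀ N)).trans (mapAddEquiv Φ₀ _ _)).symm

lemma map_homNEquiv (n : N') : Φ₀.map (stalkHomEquiv T₀ _ (homNEquiv Φ₀ T₀ e φ n)) =
    e.hom ≫ (stalk k B₀).map (evalEquiv k N' n) ≫ φ.inv :=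
  ((stalkHomEquiv T₀ (FDMod.of k A₀ N)).trans (mapAddEquiv Φ₀ _ _)).apply_symm_apply _

lemma endEquiv_mul (a b : B₀) :
    endEquiv Φ₀ T₀ e (a * b) = endEquiv Φ₀ T₀ e a ≫ endEquiv Φ₀ T₀ e b := by
  apply (KbProj.toDb k A₀).map_injective
  apply Φ₀.map_injective
  rw [Functor.map_comp, Functor.map_comp, map_endEquiv, map_endEquiv, map_endEquiv, ← smul_eq_mul,
    evalEquiv_smul, Functor.map_comp]
  simp

lemma endEquiv_algebraMap (c : k) : endEquiv Φ₀ T₀ e (algebraMap k B₀ c) = c • 𝟙 T₀ := by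
  apply (KbProj.toDb k A₀).map_injective
  apply Φ₀.map_injective
  rw [map_endEquiv, evalEquiv_algebraMap]
  simp only [Functor.map_smul, CategoryTheory.Functor.map_id, Linear.smul_comp, Linear.comp_smul,
    Category.id_comp, Iso.hom_inv_id]

lemma homNEquiv_smul (b : B₀) (n : N') :
    homNEquiv Φ₀ T₀ e φ (b • n) = (endEquiv Φ₀ T₀ e b).hom ≫ homNEquiv Φ₀ T₀ e φ n := by
  apply (stalkHomEquiv T₀ (FDMod.of k A₀ N)).injective
  apply Φ₀.map_injective
  rw [comp_stalkHomEquiv, Functor.map_comp, map_homNEquiv, map_homNEquiv, map_endEquiv,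
    evalEquiv_smul, Functor.map_comp]
  simp

/-- The transported action was chosen so that `φ` intertwines right multiplications; this is what
that choice yields on `Hom(T₀, N[0])`. -/
lemma homNEquiv_op_smul [Module Gᵐᵒᵖ N'] [SMulCommClass B₀ Gᵐᵒᵖ N'] (g : G)
    (hg : Φ₀.map ((stalk k A₀).map (FDMod.ofHom (rightMul g : N →ₗ[A₀] N))) ≫ φ.hom =
      φ.hom ≫ (stalk k B₀).map (FDMod.ofHom (rightMul g : N' →ₗ[B₀] N'))) (n : N') :
    homNEquiv Φ₀ T₀ e φ (op g • n) = homNEquiv Φ₀ T₀ e φ n ≫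
      (HomotopyCategory.singleFunctor _ 0).map (FDMod.ofHom (rightMul g : N →ₗ[A₀] N)) := by
  apply (stalkHomEquiv T₀ (FDMod.of k A₀ N)).injective
  apply Φ₀.map_injective
  have hg' : φ.inv ≫ Φ₀.map ((stalk k A₀).map (FDMod.ofHom (rightMul g : N →ₗ[A₀] N))) =
      (stalk k B₀).map (FDMod.ofHom (rightMul g : N' →ₗ[B₀] N')) ≫ φ.inv := by
    rw [Iso.inv_comp_eq, ← Category.assoc, ← hg, Category.assoc, Iso.hom_inv_id, Category.comp_id]
  have hn : evalEquiv k N' (op g • n) = evalEquiv k N' n ≫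
      FDMod.ofHom (rightMul g : N' →ₗ[B₀] N') := evalEquiv_comp (rightMul g) n
  rw [stalkHomEquiv_comp, Functor.map_comp, map_homNEquiv, map_homNEquiv, hn, Functor.map_comp,
    Category.assoc, Category.assoc, Category.assoc, hg']

end

lemma nonempty_end_kbExt_algEquiv
    (e : Φ₀.obj ((KbProj.toDb k A₀).obj T₀) ≅ (stalk k B₀).obj (FDMod.of k B₀ B₀))
    (φ : Φ₀.obj ((stalk k A₀).obj (FDMod.of k A₀ N)) ≅ (stalk k B₀).obj (FDMod.of k B₀ N'))
    [Module Gᵐᵒᵖ N'] [SMulCommClass B₀ Gᵐᵒᵖ N']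
    [IsScalarTower k Gᵐᵒᵖ N']
    (hφ : ∀ g : G, Φ₀.map ((stalk k A₀).map (FDMod.ofHom (rightMul g : N →ₗ[A₀] N))) ≫ φ.hom =
      φ.hom ≫ (stalk k B₀).map (FDMod.ofHom (rightMul g : N' →ₗ[B₀] N'))) :
    Nonempty ((End (kbExt k N G T₀))ᵐᵒᵖ ≃ₐ[k] OnePointExt B₀ N' G) := by
  obtain ⟨i₁, p₁, i₂, p₂, h₁, h₂, h₁₂, hid⟩ := exists_kbExt_decomposition k N G T₀
  refine nonempty_end_algEquiv_onePointExt i₁ p₁ i₂ p₂ h₁ h₂ h₁₂ hid (kbG_hom_ind_eq_zero k T₀)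
    ((endEquiv Φ₀ T₀ e).trans (mapAddEquiv (indKb k N G) T₀ T₀))
    ((homNEquiv Φ₀ T₀ e φ).trans (indHomEquiv k N G T₀)) (kbGEquiv k N G) ?_ ?_ ?_ ?_ ?_ ?_
  · intro a b
    simp [endEquiv_mul]
  · intro a b
    apply ObjectProperty.hom_ext
    rw [ObjectProperty.FullSubcategory.comp_hom, kbGEquiv_hom, kbGEquiv_hom, kbGEquiv_hom, mulG_mul]
    exact Functor.map_comp _ _ _
  · intro a m
    simp [homNEquiv_smul, comp_indHomEquiv]
  · intro m s
    simp [homNEquiv_op_smul Φ₀ T₀ e φ s (hφ s), indHomEquiv_comp]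
  · intro c
    simp only [AddEquiv.trans_apply, endEquiv_algebraMap, mapAddEquiv_apply, Functor.map_smul,
      CategoryTheory.Functor.map_id]
  · intro c
    apply ObjectProperty.hom_ext
    rw [kbGEquiv_hom, mulG_algebraMap, Functor.map_smul, CategoryTheory.Functor.map_id]
    rfl

end Main

end OnePoint

end

theorem mainTheorem4
    {k : Type w} [Field k]
    {A₀ : Type u} [Ring A₀] [Algebra k A₀] [FiniteDimensional k A₀]
    {B₀ : Type u} [Ring B₀] [Algebra k B₀] [FiniteDimensional k B₀]
    [HasDerivedCategory.{v₁} (FDMod k A₀)] [HasDerivedCategory.{v₂} (FDMod k B₀)]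
    -- a `k`-linear triangle equivalence from `D^b(A₀-mod)` to `D^b(B₀-mod)`
    (Φ₀ : DerivedCategory.Bounded (FDMod k A₀) ⥤ DerivedCategory.Bounded (FDMod k B₀))
    [Φ₀.IsEquivalence] [Φ₀.CommShift ℤ] [Φ₀.IsTriangulated] [Φ₀.Linear k]
    -- a tilting complex over `A₀` with `Φ₀(T₀) ≅ B₀`
    (T₀ : KbProj k A₀) (hT₀ : IsTiltingComplex T₀)
    (hΦT₀ : Nonempty (Φ₀.obj ((KbProj.toDb k A₀).obj T₀) ≅ (stalk k B₀).obj (FDMod.of k B₀ B₀)))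
    -- a finite-dimensional division algebra `G`
    {G : Type u} [DivisionRing G] [Algebra k G] [FiniteDimensional k G]
    -- a finite-dimensional `A₀`-`G`-bimodule `N` on which `k` acts centrally
    {N : Type u} [AddCommGroup N] [Module k N] [FiniteDimensional k N]
    [Module A₀ N] [Module Gᵐᵒᵖ N] [SMulCommClass A₀ Gᵐᵒᵖ N]
    [IsScalarTower k A₀ N] [IsScalarTower k Gᵐᵒᵖ N]
    -- a left `B₀`-module `N'` and an isomorphism `Φ₀(N) ≅ N'` in `D^b(B₀-mod)`
    {N' : Type u} [AddCommGroup N'] [Module k N'] [FiniteDimensional k N']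
    [Module B₀ N'] [IsScalarTower k B₀ N']
    (φ : Φ₀.obj ((stalk k A₀).obj (FDMod.of k A₀ N)) ≅ (stalk k B₀).obj (FDMod.of k B₀ N')) :
    -- `N'` is a `B₀`-`G`-bimodule, the right action being that on `N` carried over by `Φ₀`, `φ`
    ∃ (_ : Module Gᵐᵒᵖ N') (_ : SMulCommClass B₀ Gᵐᵒᵖ N') (_ : IsScalarTower k Gᵐᵒᵖ N'),
      (∀ g : G, Φ₀.map ((stalk k A₀).map (FDMod.ofHom (rightMul g : N →ₗ[A₀] N))) ≫ φ.hom =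
        φ.hom ≫ (stalk k B₀).map (FDMod.ofHom (rightMul g : N' →ₗ[B₀] N'))) ∧
      -- `T` lies in `K^b(A-proj)`, is tilting, and its opposite endomorphism algebra is `B`
      ∃ hT : isBoundedProj k (OnePointExt A₀ N G)
          ((HomotopyCategory.quotient _ _).obj (extComplex k N G T₀.obj.as)),
        IsTiltingComplex (⟨_, hT⟩ : KbProj k (OnePointExt A₀ N G)) ∧
        Nonempty ((End (⟨_, hT⟩ : KbProj k (OnePointExt A₀ N G)))ᵐᵒᵖ ≃ₐ[k]
          OnePointExt B₀ N' G) := by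
  obtain ⟨e⟩ := hΦT₀
  obtain ⟨m, sc, st, hφ⟩ := exists_transported_bimodule (G := G) Φ₀ φ
  exact ⟨m, sc, st, hφ, isBoundedProj_extComplex k T₀,
    isTiltingComplex_kbExt Φ₀ T₀ e φ hT₀, nonempty_end_kbExt_algEquiv Φ₀ T₀ e φ hφ⟩
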